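/- Let $\mathcal X_1,\mathcal Y_1,\mathcal X_2,\mathcal Y_2$ be finite alphabets, $p(y_1|x_1)$ and $p(y_2|x_2)$ two discrete memoryless channels, $c_1:\mathcal X_1\to\mathbb R_+$ and $c_2:\mathcal X_2\to\mathbb R_+$ input cost functions, $b:\mathcal Y_1\to\mathbb R_+$ an energy function, and $P_1,P_2\in\mathbb R$. Assume that some $x_1$ satisfies $c_1(x_1)\le P_1$ and that some $x_2$ satisfies $c_2(x_2)\le P_2+b(y_1)$ for all $y_1$ (both hold, in particular, if each of $c_1,c_2$ vanishes at some symbol and $P_1,P_2\ge 0$). A $(2^{nR},P_1,P_2,n)$ code for the two-hop channel with a harvesting relay consists of (i) a message set with $2^{\lceil nR\rceil}$ elements; (ii) an encoder that assigns to each message $m$ a codeword $x_1^n(m)\in\mathcal X_1^n$ with $\frac1n\sum_{i=1}^n c_1(x_{1i}(m))\le P_1$; (iii) a relay encoder that for each time $i\in\{1,\dots,n\}$ assigns a symbol $x_{2i}(y_1^{i-1})\in\mathcal X_2$ to each past received sequence $y_1^{i-1}\in\mathcal Y_1^{i-1}$, such that $\frac1n\sum_{i=1}^n c_2(x_{2i}(y_1^{i-1}))\le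 \frac1n\sum_{i=1}^n b(y_{1i})+P_2$ for every message and every sequence $y_1^n$ that the relay receives with positive probability when that message is sent; (iv) a decoder that assigns a message estimate $\hat m$ to each $y_2^n\in\mathcal Y_2^n$. A rate $R\ge 0$ is achievable if there are such codes for $n=1,2,\dots$ whose probability of error $\Pr\{\hat M\ne M\}$, for $M$ uniformly distributed over the messages, tends to $0$ as $n\to\infty$. The capacity-energy function $\mathcal C_e(P_1,P_2)$ is the supremum of the set of achievable rates. Then the set of achievable rates is nonempty and bounded above, and $$\mathcal C_e(P_1,P_2)=\max_{p(x_1):\,\mathrm E[c_1(X_1)]\le P_1}\ \min\Big\{ I(X_1;Y_1),\ \max_{p(x_2):\,\mathrm E[c_2(X_2)]\le \mathrm E[b(Y_1)]+P_2} I(X_2;Y_2)\Big\},$$ where both maxima are attained, $X_k$ has pmf $p(x_k)$, $Y_k$ is the output of the $k$-th channel for the input $X_k$, and mutual information is measured in bits. -/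

import Mathlib

open Filter Topology

namespace MultiHop

/-- A discrete memoryless channel `p(y|x)` from the alphabet `X` to the alphabet `Y`. -/
structure DMC (X Y : Type*) [Fintype Y] where
  prob : X → Y → ℝ
  nonneg : ∀ x y, 0 ≤ prob x y
  sum_one : ∀ x, ∑ y, prob x y = 1

/-- Probability that `n` uses of the channel map the input word `x` to the output word `y`. -/
noncomputable def DMC.wordProb {X Y : Type*} [Fintype Y] (W : DMC X Y) {n : ℕ}
    (x : Fin n → X) (y : Fin n → Y) : ℝ :=
  ∏ i, W.prob (x i) (y i)

/-- Mutual information, in bits, of a pair with joint pmf `q` (with `0 log 0 = 0`). -/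
noncomputable def mutualInfo {X Y : Type*} [Fintype X] [Fintype Y] (q : X → Y → ℝ) : ℝ :=
  ∑ x, ∑ y, q x y * Real.logb 2 (q x y / ((∑ y', q x y') * ∑ x', q x' y))

/-- `I(X;Y)` for an input with pmf `p` sent through the channel `W`. -/
noncomputable def DMC.info {X Y : Type*} [Fintype X] [Fintype Y] (W : DMC X Y)
    (p : X → ℝ) : ℝ :=
  mutualInfo fun x y => p x * W.prob x y

/-- The data of a two-hop channel with a harvesting relay: the two channels, the input cost
functions of the encoder and of the relay, and the energy harvested from a symbol that the relay
receives. -/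
structure Network (X₁ Y₁ X₂ Y₂ : Type*) [Fintype Y₁] [Fintype Y₂] where
  W₁ : DMC X₁ Y₁
  W₂ : DMC X₂ Y₂
  c₁ : X₁ → ℝ
  c₂ : X₂ → ℝ
  b : Y₁ → ℝ
  c₁_nonneg : ∀ x, 0 ≤ c₁ x
  c₂_nonneg : ∀ x, 0 ≤ c₂ x
  b_nonneg : ∀ y, 0 ≤ b y

section

variable {X₁ Y₁ X₂ Y₂ : Type*} [Fintype X₁] [Fintype Y₁] [Fintype X₂] [Fintype Y₂]

/-- The relay's word `x₂ⁿ` when it receives `y`: its `i`-th symbol depends only on the symbols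
received strictly before time `i`. -/
def relayWord {n : ℕ} (relay : (i : Fin n) → (Fin (i : ℕ) → Y₁) → X₂) (y : Fin n → Y₁) :
    Fin n → X₂ :=
  fun i => relay i fun j => y (Fin.castLE i.isLt.le j)

/-- A code with `M` messages and block length `n`. The encoder's cost constraint holds for every
message, the relay's for every message and every word that the relay can receive. -/
structure Code (N : Network X₁ Y₁ X₂ Y₂) (P₁ P₂ : ℝ) (M n : ℕ) where
  enc : Fin M → Fin n → X₁
  relay : (i : Fin n) → (Fin (i : ℕ) → Y₁) → X₂
  dec : (Fin n → Y₂) → Fin M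
  enc_cost : ∀ m, (1 / (n : ℝ)) * ∑ i, N.c₁ (enc m i) ≤ P₁
  relay_cost : ∀ m (y : Fin n → Y₁), 0 < N.W₁.wordProb (enc m) y →
    (1 / (n : ℝ)) * ∑ i, N.c₂ (relayWord relay y i) ≤ (1 / (n : ℝ)) * ∑ i, N.b (y i) + P₂

open Classical in
/-- Average probability of error, for a message that is uniform on the `M` messages. -/
noncomputable def Code.errorProb {N : Network X₁ Y₁ X₂ Y₂} {P₁ P₂ : ℝ} {M n : ℕ}
    (C : Code N P₁ P₂ M n) : ℝ :=
  (1 / (M : ℝ)) * ∑ m, ∑ y₁ : Fin n → Y₁, ∑ y₂ : Fin n → Y₂,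
    if C.dec y₂ ≠ m then
      N.W₁.wordProb (C.enc m) y₁ * N.W₂.wordProb (relayWord C.relay y₁) y₂
    else 0

/-- `R` is achievable: for every block length `n ≥ 1` there is a code with `2 ^ ⌈nR⌉` messages
such that the error probability tends to `0`. -/
def Achievable (N : Network X₁ Y₁ X₂ Y₂) (P₁ P₂ R : ℝ) : Prop :=
  0 ≤ R ∧ ∃ C : (n : ℕ+) → Code N P₁ P₂ (2 ^ ⌈((n : ℕ) : ℝ) * R⌉₊) (n : ℕ),
    Tendsto (fun n => (C n).errorProb) atTop (𝓝 0)

/-- The capacity-energy function: the supremum of the achievable rates. -/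
noncomputable def capacityEnergy (N : Network X₁ Y₁ X₂ Y₂) (P₁ P₂ : ℝ) : ℝ :=
  sSup {R | Achievable N P₁ P₂ R}

/-- The pmfs `p(x₁)` with `E[c₁(X₁)] ≤ P₁`. -/
def inputs₁ (N : Network X₁ Y₁ X₂ Y₂) (P₁ : ℝ) : Set (X₁ → ℝ) :=
  {p | p ∈ stdSimplex ℝ X₁ ∧ ∑ x, p x * N.c₁ x ≤ P₁}

/-- `E[b(Y₁)]` when `X₁` has pmf `p`. -/
noncomputable def harvest (N : Network X₁ Y₁ X₂ Y₂) (p : X₁ → ℝ) : ℝ :=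
  ∑ x, ∑ y, p x * N.W₁.prob x y * N.b y

/-- The pmfs `p(x₂)` with `E[c₂(X₂)] ≤ B`. -/
def inputs₂ (N : Network X₁ Y₁ X₂ Y₂) (B : ℝ) : Set (X₂ → ℝ) :=
  {p | p ∈ stdSimplex ℝ X₂ ∧ ∑ x, p x * N.c₂ x ≤ B}

/-- The supremum of `I(X₂;Y₂)` over the pmfs `p(x₂)` with `E[c₂(X₂)] ≤ B`. -/
noncomputable def secondHop (N : Network X₁ Y₁ X₂ Y₂) (B : ℝ) : ℝ :=
  sSup (N.W₂.info '' inputs₂ N B)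

end

end MultiHop

/-! Converse. The relay's word is a function of what it receives, and nothing flows back from the
second channel to the first, so each hop must carry the whole message. The change of measure in
`DMC.accept_mul_logb_le`, playing the role of Fano's inequality, bounds what a hop carries by n
times the information of its time-averaged input. Costs and harvested energy are linear in the input
pmf, so the two averaged inputs form a feasible pair (`Code.exists_inputs`).

Achievability. Block Markov decode-and-forward: K sub-messages travel over K + 1 blocks, and the
relay re-encodes in each block what it decoded in the previous one. The rate factor K / (K + 1)
tends to 1. The difficulty is that the relay's energy constraint must hold for every word it can
receive, not just with high probability. Feinstein's lemma (`exists_maximal_code`) lets cost and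
energy enter the decoding test, so a decoded block has certainly harvested at least β per letter
(`DMC.exists_block_code`). The relay idles in its first block, and the reserve gained there covers
the deficit of one undecoded block, after which it idles for good (`sum_surplus_nonneg`). Inputs on
the boundary of a constraint are approximated by cheaper ones; if there are none, only extremal
symbols occur and the bound holds surely. `EventuallyAbove` covers both cases.

Both maxima are attained because information is continuous on the simplex and the feasible inputs
form compact sets. -/

namespace MultiHop

/-! ### Product distributions and their marginals -/

section Product

theorem sum_prod_eq_one {ι Y : Type*} [Fintype ι] [Fintype Y] [DecidableEq ι]
    (w : ι → Y → ℝ) (hw : ∀ i, ∑ y, w i y = 1) : ∑ z : ι → Y, ∏ i, w i (z i) = 1 := by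
  rw [← Fintype.prod_sum]
  simp [hw]

/-- The marginal of a product distribution along an injection of the index sets. -/
theorem sum_prod_comp {ι κ Y : Type*} [Fintype ι] [Fintype κ] [Fintype Y] [DecidableEq ι]
    [DecidableEq κ] (e : ι → κ) (he : Function.Injective e) (w : κ → Y → ℝ)
    (hw : ∀ k, ∑ y, w k y = 1) (F : (ι → Y) → ℝ) :
    ∑ y : κ → Y, (∏ k, w k (y k)) * F (y ∘ e) = ∑ z : ι → Y, (∏ i, w (e i) (z i)) * F z := by
  classical
  let E : ι ⊕ ↥(Set.range e)ᶜ ≃ κ :=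
    ((Equiv.ofInjective e he).sumCongr (Equiv.refl _)).trans (Equiv.Set.sumCompl (Set.range e))
  have hE1 : ∀ i, E (Sum.inl i) = e i := fun i => by simp [E]
  let T : (ι → Y) × (↥(Set.range e)ᶜ → Y) ≃ (κ → Y) :=
    (Equiv.sumArrowEquivProdArrow _ _ _).symm.trans (Equiv.arrowCongr E (Equiv.refl _))
  rw [← T.sum_comp, Fintype.sum_prod_type]
  refine Finset.sum_congr rfl fun z _ => ?_
  have h1 : ∀ r, T (z, r) ∘ e = z := fun r => by
    funext i
    have : E.symm (e i) = Sum.inl i := by rw [← hE1, E.symm_apply_apply]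
    simp [T, this]
  have h2 : ∀ r, (∏ k, w k (T (z, r) k))
      = (∏ i, w (e i) (z i)) * ∏ j, w (E (Sum.inr j)) (r j) := fun r => by
    rw [← E.prod_comp, Fintype.prod_sum_type]
    congr 1
    · refine Finset.prod_congr rfl fun i _ => ?_
      have := congrFun (h1 r) i
      simp only [Function.comp] at this
      rw [hE1, this]
    · refine Finset.prod_congr rfl fun j _ => ?_
      simp [T]
  simp_rw [h1, h2]
  rw [← Finset.sum_mul, ← Finset.mul_sum, sum_prod_eq_one _ (fun j => hw _), mul_one]

theorem sum_prod_apply {κ Y : Type*} [Fintype κ] [Fintype Y] [DecidableEq κ]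
    (w : κ → Y → ℝ) (hw : ∀ k, ∑ y, w k y = 1) (k : κ) (F : Y → ℝ) :
    ∑ y : κ → Y, (∏ k, w k (y k)) * F (y k) = ∑ a, w k a * F a := by
  have := sum_prod_comp (fun _ : Unit => k) (fun _ _ _ => rfl) w hw (fun z => F (z ()))
  simp only [Function.comp] at this
  rw [this, ← (Equiv.funUnique Unit Y).symm.sum_comp]
  simp

end Product

/-! ### The weak law of large numbers, one-sided -/

section WeakLaw

variable {Z : Type*} [Fintype Z]

theorem sum_prod_mul_sum_eq_zero (π : Z → ℝ) (hπ : ∑ z, π z = 1) (f : Z → ℝ)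
    (hf : ∑ z, π z * f z = 0) (n : ℕ) :
    ∑ z : Fin n → Z, (∏ i, π (z i)) * ∑ i, f (z i) = 0 := by
  simp_rw [Finset.mul_sum]
  rw [Finset.sum_comm]
  refine Finset.sum_eq_zero fun i _ => ?_
  rw [sum_prod_apply (fun _ => π) (fun _ => hπ) i f, hf]

/-- Independent centred letters have no cross terms: peeling off the first letter leaves its
variance, a term killed by `sum_prod_mul_sum_eq_zero`, and the shorter sum. -/
theorem sum_prod_mul_sum_sq (π : Z → ℝ) (hπ : ∑ z, π z = 1) (f : Z → ℝ)
    (hf : ∑ z, π z * f z = 0) (n : ℕ) :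
    ∑ z : Fin n → Z, (∏ i, π (z i)) * (∑ i, f (z i)) ^ 2 = n * ∑ z, π z * f z ^ 2 := by
  induction n with
  | zero => simp
  | succ n ih =>
    rw [← (Fin.consEquiv fun _ => Z).sum_comp, Fintype.sum_prod_type]
    have h : ∀ (a : Z) (z : Fin n → Z),
        (∏ i, π ((Fin.consEquiv fun _ => Z) (a, z) i)) *
          (∑ i, f ((Fin.consEquiv fun _ => Z) (a, z) i)) ^ 2 =
        π a * f a ^ 2 * (∏ i, π (z i)) + π a * f a * 2 * ((∏ i, π (z i)) * ∑ i, f (z i))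
          + π a * ((∏ i, π (z i)) * (∑ i, f (z i)) ^ 2) := fun a z => by
      simp only [Fin.consEquiv_apply, Fin.prod_univ_succ, Fin.sum_univ_succ, Fin.cons_zero,
        Fin.cons_succ]
      ring
    simp_rw [h, Finset.sum_add_distrib, ← Finset.mul_sum, ih,
      sum_prod_mul_sum_eq_zero π hπ f hf, sum_prod_eq_one (fun _ : Fin n => π) (fun _ => hπ)]
    rw [← Finset.sum_mul Finset.univ π, hπ]
    push_cast
    simp
    ring

/-- The i.i.d. sums of `f` are asymptotically at least `n * G`: either because the mean is larger
or because `f` is at least `G` almost surely. -/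
def EventuallyAbove (π f : Z → ℝ) (G : ℝ) : Prop :=
  G < ∑ z, π z * f z ∨ ∀ z, π z ≠ 0 → G ≤ f z

-- Chebyshev's inequality if the mean exceeds G; otherwise the event is null for every n.
open Classical in
theorem tendsto_lower_tail (π : Z → ℝ) (hπ : π ∈ stdSimplex ℝ Z) (f : Z → ℝ) (G : ℝ)
    (h : EventuallyAbove π f G) :
    Tendsto (fun n : ℕ => ∑ z : Fin n → Z,
      (∏ i, π (z i)) * if ∑ i, f (z i) < n * G then 1 else 0) atTop (𝓝 0) := by
  have h0 : ∀ n (z : Fin n → Z), 0 ≤ ∏ i, π (z i) := fun n z =>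
    Finset.prod_nonneg fun i _ => hπ.1 _
  rcases h with h | h
  · set μ := ∑ z, π z * f z with hμ
    set g : Z → ℝ := fun z => f z - μ with hg
    have hg0 : ∑ z, π z * g z = 0 := by
      simp [hg, mul_sub, Finset.sum_sub_distrib, ← Finset.sum_mul, hπ.2, ← hμ]
    set v := ∑ z, π z * g z ^ 2
    have hδ : 0 < μ - G := sub_pos.2 h
    have hbd : ∀ n : ℕ, 0 < n → ∑ z : Fin n → Z,
        (∏ i, π (z i)) * (if ∑ i, f (z i) < n * G then 1 else 0) ≤ (v / (μ - G) ^ 2) / n := by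
      intro n hn
      have hn' : (0 : ℝ) < n := Nat.cast_pos.2 hn
      have hstep : ∑ z : Fin n → Z,
          (∏ i, π (z i)) * (if ∑ i, f (z i) < n * G then 1 else 0) ≤
          ∑ z : Fin n → Z, ((∏ i, π (z i)) * (∑ i, g (z i)) ^ 2) * (1 / (n * (μ - G)) ^ 2) := by
        refine Finset.sum_le_sum fun z _ => ?_
        rw [mul_assoc]
        refine mul_le_mul_of_nonneg_left ?_ (h0 n z)
        split_ifs with hz
        · rw [mul_one_div, le_div_iff₀ (by positivity), one_mul]
          have : ∑ i, g (z i) = ∑ i, f (z i) - n * μ := by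
            simp [hg, Finset.sum_sub_distrib]
          rw [this]
          have h1 : 0 ≤ n * (μ - G) := by positivity
          have h2 : n * (μ - G) ≤ n * μ - ∑ i, f (z i) := by linarith
          nlinarith
        · positivity
      refine hstep.trans (le_of_eq ?_)
      rw [← Finset.sum_mul, sum_prod_mul_sum_sq π hπ.2 g hg0]
      simp only [v]
      field_simp
    refine tendsto_of_tendsto_of_tendsto_of_le_of_le' tendsto_const_nhds
      (tendsto_const_div_atTop_nhds_zero_nat (v / (μ - G) ^ 2)) ?_ ?_
    · refine Eventually.of_forall fun n => Finset.sum_nonneg fun z _ => ?_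
      have := h0 n z
      split_ifs <;> simp [this]
    · filter_upwards [eventually_gt_atTop 0] with n hn using hbd n hn
  · refine tendsto_const_nhds.congr fun n => ?_
    symm
    refine Finset.sum_eq_zero fun z _ => ?_
    by_cases hz : ∏ i, π (z i) = 0
    · simp [hz]
    · rw [if_neg, mul_zero]
      rw [← ne_eq, Finset.prod_ne_zero_iff] at hz
      have := Finset.sum_le_sum fun i (hi : i ∈ Finset.univ) => h (z i) (hz i hi)
      simpa using this

end WeakLaw

/-! ### Feinstein's greedy code construction -/

section MaximalCode

open Classical in
/-- Feinstein's maximal code lemma. -/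
theorem exists_maximal_code {X Y : Type*} [Fintype X] [Fintype Y] (W : X → Y → ℝ)
    (hW : ∀ x y, 0 ≤ W x y) (P : X → ℝ) (hP : P ∈ stdSimplex ℝ X)
    (T : X → Y → Prop) (Γ : ℝ) (hΓ : 0 < Γ)
    (hT : ∀ x y, T x y → Γ * ∑ x', P x' * W x' y ≤ W x y)
    (hW1 : ∀ x, ∑ y, W x y = 1) (ε : ℝ) (M : ℕ)
    (hM : 1 - ε + M / Γ < ∑ x, ∑ y, P x * W x y * if T x y then 1 else 0) :
    ∃ (enc : Fin M → X) (D : Fin M → Finset Y), Pairwise (fun i j => Disjoint (D i) (D j)) ∧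
      (∀ m, ∀ y ∈ D m, T (enc m) y) ∧ ∀ m, 1 - ε ≤ ∑ y ∈ D m, W (enc m) y := by
  induction M with
  | zero => exact ⟨Fin.elim0, Fin.elim0, fun i => i.elim0, fun i => i.elim0, fun i => i.elim0⟩
  | succ M ih =>
    obtain ⟨enc, D, hD, hDT, hDW⟩ := ih (lt_of_le_of_lt (by gcongr; simp) hM)
    set Q : Y → ℝ := fun y => ∑ x', P x' * W x' y with hQ
    let U : Finset Y := Finset.univ.biUnion D
    -- Each word of a decoding set is at least Γ times likelier under its codeword than under the
    -- output law Q, so each set has Q-mass at most 1 / Γ.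
    have hQU : ∑ y ∈ U, Q y ≤ M / Γ := by
      calc ∑ y ∈ U, Q y ≤ ∑ m, ∑ y ∈ D m, Q y := by
            rw [Finset.sum_biUnion (fun i _ j _ hij => hD hij)]
        _ ≤ ∑ m : Fin M, 1 / Γ := by
            refine Finset.sum_le_sum fun m _ => ?_
            rw [le_div_iff₀ hΓ, Finset.sum_mul]
            calc ∑ y ∈ D m, Q y * Γ ≤ ∑ y ∈ D m, W (enc m) y :=
                  Finset.sum_le_sum fun y hy => by rw [mul_comm]; exact hT _ _ (hDT m y hy)
              _ ≤ ∑ y, W (enc m) y :=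
                  Finset.sum_le_sum_of_subset_of_nonneg (Finset.subset_univ _) fun y _ _ => hW _ _
              _ = 1 := hW1 _
        _ = M / Γ := by simp [div_eq_mul_inv]
    -- If no further codeword existed, averaging over P would bound the mass of the test by 1 - ε +
    -- Q(U), contradicting `hM`.
    obtain ⟨x, hx⟩ : ∃ x, 1 - ε ≤ ∑ y ∈ Finset.univ.filter (fun y => T x y ∧ y ∉ U), W x y := by
      by_contra! hcon
      have h1 : ∑ x, ∑ y, P x * W x y * (if T x y then 1 else 0) ≤
          ∑ x, P x * (1 - ε) + ∑ y ∈ U, Q y := by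
        calc ∑ x, ∑ y, P x * W x y * (if T x y then 1 else 0)
            ≤ ∑ x, ∑ y, (P x * (if T x y ∧ y ∉ U then W x y else 0)
                + if y ∈ U then P x * W x y else 0) := by
              refine Finset.sum_le_sum fun x _ => Finset.sum_le_sum fun y _ => ?_
              have := mul_nonneg (hP.1 x) (hW x y)
              by_cases h1 : T x y <;> by_cases h2 : y ∈ U <;> simp [h1, h2, this]
          _ = ∑ x, P x * ∑ y ∈ Finset.univ.filter (fun y => T x y ∧ y ∉ U), W x y
                + ∑ y ∈ U, Q y := by
              simp_rw [Finset.sum_add_distrib, ← Finset.mul_sum, Finset.sum_filter]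
              congr 1
              rw [Finset.sum_comm, ← Finset.sum_filter_add_sum_filter_not Finset.univ (· ∈ U)]
              rw [Finset.filter_mem_eq_inter, Finset.univ_inter,
                Finset.sum_eq_zero (s := Finset.univ.filter _)
                  (fun y hy => by simp [(Finset.mem_filter.1 hy).2]), add_zero]
              exact Finset.sum_congr rfl fun y hy => by simp [hy, hQ]
          _ ≤ _ := by
              gcongr with x
              · exact hP.1 x
              · exact (hcon x).le
      rw [← Finset.sum_mul, hP.2, one_mul] at h1
      have h2 : (M : ℝ) / Γ ≤ ((M + 1 : ℕ) : ℝ) / Γ := by gcongr; simp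
      linarith
    refine ⟨Fin.cons x enc, Fin.cons (Finset.univ.filter (fun y => T x y ∧ y ∉ U)) D, ?_, ?_, ?_⟩
    · have hdis : ∀ j, Disjoint (Finset.univ.filter (fun y => T x y ∧ y ∉ U)) (D j) := fun j => by
        rw [Finset.disjoint_left]
        intro y hy hyj
        exact (Finset.mem_filter.1 hy).2.2 (Finset.mem_biUnion.2 ⟨j, Finset.mem_univ _, hyj⟩)
      intro i j hij
      induction i using Fin.cases with
      | zero =>
        induction j using Fin.cases with
        | zero => exact absurd rfl hij
        | succ j => simpa using hdis j
      | succ i =>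
        induction j using Fin.cases with
        | zero => simpa using (hdis i).symm
        | succ j => simpa using hD (fun h => hij (by rw [h]))
    · intro m
      induction m using Fin.cases with
      | zero => simp +contextual
      | succ m => simpa using hDT m
    · intro m
      induction m using Fin.cases with
      | zero => simpa using hx
      | succ m => simpa using hDW m

end MaximalCode

/-! ### Mutual information and its continuity -/

section Information

variable {X Y : Type*} [Fintype X] [Fintype Y]

/-- The output pmf for the input pmf `p`. -/
noncomputable def DMC.out (W : DMC X Y) (p : X → ℝ) (y : Y) : ℝ :=
  ∑ x, p x * W.prob x y

/-- The information density of an input symbol and an output symbol, in bits. -/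
noncomputable def DMC.density (W : DMC X Y) (p : X → ℝ) (x : X) (y : Y) : ℝ :=
  Real.logb 2 (W.prob x y / W.out p y)

theorem DMC.out_nonneg (W : DMC X Y) {p : X → ℝ} (hp : ∀ x, 0 ≤ p x) (y : Y) : 0 ≤ W.out p y :=
  Finset.sum_nonneg fun x _ => mul_nonneg (hp x) (W.nonneg x y)

theorem DMC.sum_out (W : DMC X Y) {p : X → ℝ} (hp : ∑ x, p x = 1) : ∑ y, W.out p y = 1 := by
  unfold DMC.out
  rw [Finset.sum_comm]
  simp [← Finset.mul_sum, W.sum_one, hp]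

theorem DMC.out_pos (W : DMC X Y) {p : X → ℝ} (hp : ∀ x, 0 ≤ p x) {x : X} {y : Y}
    (hx : p x ≠ 0) (hxy : W.prob x y ≠ 0) : 0 < W.out p y := by
  refine lt_of_lt_of_le
    (mul_pos ((hp x).lt_of_ne' hx) ((W.nonneg x y).lt_of_ne' hxy)) ?_
  exact Finset.single_le_sum (f := fun x => p x * W.prob x y)
    (fun x _ => mul_nonneg (hp x) (W.nonneg x y)) (Finset.mem_univ x)

theorem DMC.info_eq (W : DMC X Y) (p : X → ℝ) :
    W.info p = ∑ x, p x * ∑ y, W.prob x y * W.density p x y := by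
  unfold DMC.info mutualInfo
  refine Finset.sum_congr rfl fun x _ => ?_
  rw [Finset.mul_sum]
  refine Finset.sum_congr rfl fun y _ => ?_
  rw [← Finset.mul_sum, W.sum_one, mul_one, ← mul_assoc]
  by_cases hx : p x = 0
  · simp [hx]
  · rw [mul_div_mul_left _ _ hx]
    rfl

/-- I(X;Y) = H(Y) - H(Y|X). The conditional part is linear in p and the output entropy is continuous
even where an output probability vanishes. -/
theorem DMC.info_eq_sub (W : DMC X Y) {p : X → ℝ} (hp : ∀ x, 0 ≤ p x) :
    W.info p = ∑ x, p x * ∑ y, W.prob x y * Real.logb 2 (W.prob x y)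
      + (∑ y, Real.negMulLog (W.out p y)) / Real.log 2 := by
  have h : ∀ x y, p x * (W.prob x y * W.density p x y) =
      p x * (W.prob x y * Real.logb 2 (W.prob x y)) -
        p x * W.prob x y * Real.logb 2 (W.out p y) := by
    intro x y
    by_cases hx : p x = 0
    · simp [hx]
    by_cases hxy : W.prob x y = 0
    · simp [hxy]
    rw [DMC.density, Real.logb_div hxy (W.out_pos hp hx hxy).ne']
    ring
  rw [W.info_eq]
  simp_rw [Finset.mul_sum, h, Finset.sum_sub_distrib]
  rw [sub_eq_add_neg]
  congr 1
  rw [Finset.sum_comm, ← Finset.sum_neg_distrib, Finset.sum_div]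
  refine Finset.sum_congr rfl fun y _ => ?_
  rw [← Finset.sum_mul, Real.negMulLog, Real.logb, DMC.out]
  ring

theorem DMC.continuousOn_info (W : DMC X Y) : ContinuousOn W.info (stdSimplex ℝ X) := by
  refine ContinuousOn.congr (f := fun p : X → ℝ =>
    ∑ x, p x * ∑ y, W.prob x y * Real.logb 2 (W.prob x y)
      + (∑ y, Real.negMulLog (W.out p y)) / Real.log 2) ?_ fun p hp => W.info_eq_sub hp.1
  refine Continuous.continuousOn ?_
  unfold DMC.out
  have : Continuous Real.negMulLog := Real.continuous_negMulLog
  fun_prop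

end Information

/-! ### Feasible inputs and attainment of the maxima -/

section Network

variable {X₁ Y₁ X₂ Y₂ : Type*} [Fintype Y₁] [Fintype Y₂]

theorem continuous_harvest [Fintype X₁] (N : Network X₁ Y₁ X₂ Y₂) : Continuous (harvest N) := by
  unfold harvest
  fun_prop

theorem isCompact_inputs₂ [Fintype X₂] (N : Network X₁ Y₁ X₂ Y₂) (B : ℝ) : IsCompact (inputs₂ N B) := by
  refine (isCompact_stdSimplex ℝ X₂).inter_right (t := {p | ∑ x, p x * N.c₂ x ≤ B}) ?_
  exact isClosed_le (by fun_prop) continuous_const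

theorem le_harvest [Fintype X₁] (N : Network X₁ Y₁ X₂ Y₂) {p : X₁ → ℝ} (hp : p ∈ stdSimplex ℝ X₁) {β : ℝ}
    (hβ : ∀ y, β ≤ N.b y) : β ≤ harvest N p := by
  have : β = ∑ x, ∑ y, p x * N.W₁.prob x y * β := by
    simp_rw [← Finset.sum_mul, ← Finset.mul_sum, N.W₁.sum_one, mul_one, hp.2, one_mul]
  rw [this]
  unfold harvest
  gcongr with x _ y _
  · exact mul_nonneg (hp.1 x) (N.W₁.nonneg x y)
  · exact hβ y

theorem inputs₁_nonempty [Fintype X₁] (N : Network X₁ Y₁ X₂ Y₂) {P₁ : ℝ} (h : ∃ x₁, N.c₁ x₁ ≤ P₁) :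
    (inputs₁ N P₁).Nonempty := by
  classical
  obtain ⟨x, hx⟩ := h
  exact ⟨Pi.single x 1, single_mem_stdSimplex ℝ x, by simpa [Pi.single_apply] using hx⟩

theorem inputs₂_nonempty [Fintype X₂] (N : Network X₁ Y₁ X₂ Y₂) {B : ℝ} (h : ∃ x₂, N.c₂ x₂ ≤ B) :
    (inputs₂ N B).Nonempty := by
  classical
  obtain ⟨x, hx⟩ := h
  exact ⟨Pi.single x 1, single_mem_stdSimplex ℝ x, by simpa [Pi.single_apply] using hx⟩

theorem inputs₂_harvest_nonempty [Fintype X₁] [Fintype X₂] (N : Network X₁ Y₁ X₂ Y₂) {P₂ : ℝ}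
    (h : ∃ x₂, ∀ y₁, N.c₂ x₂ ≤ N.b y₁ + P₂) {p : X₁ → ℝ} (hp : p ∈ stdSimplex ℝ X₁) :
    (inputs₂ N (harvest N p + P₂)).Nonempty := by
  obtain ⟨x, hx⟩ := h
  refine inputs₂_nonempty N ⟨x, ?_⟩
  have := le_harvest N hp (β := N.c₂ x - P₂) fun y => by linarith [hx y]
  linarith

theorem isGreatest_secondHop [Fintype X₂] (N : Network X₁ Y₁ X₂ Y₂) {B : ℝ} (h : (inputs₂ N B).Nonempty) :
    IsGreatest (N.W₂.info '' inputs₂ N B) (secondHop N B) :=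
  ((isCompact_inputs₂ N B).image_of_continuousOn
    (N.W₂.continuousOn_info.mono fun _ hp => hp.1)).isGreatest_sSup (h.image _)

/-- The value of a pair of inputs under which the outer maximum is attained. -/
theorem exists_isGreatest_min [Fintype X₁] [Fintype X₂] (N : Network X₁ Y₁ X₂ Y₂) {P₁ P₂ : ℝ} (h₁ : ∃ x₁, N.c₁ x₁ ≤ P₁)
    (h₂ : ∃ x₂, ∀ y₁, N.c₂ x₂ ≤ N.b y₁ + P₂) :
    ∃ V, IsGreatest ((fun p₁ => min (N.W₁.info p₁) (secondHop N (harvest N p₁ + P₂))) ''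
      inputs₁ N P₁) V := by
  -- Maximising jointly over feasible pairs, a compact set, avoids any continuity of `secondHop` in
  -- the energy budget.
  let K : Set ((X₁ → ℝ) × (X₂ → ℝ)) :=
    {p | p.1 ∈ inputs₁ N P₁ ∧ p.2 ∈ inputs₂ N (harvest N p.1 + P₂)}
  have hK : IsCompact K := by
    have hcl : IsClosed {p : (X₁ → ℝ) × (X₂ → ℝ) |
        ∑ x, p.1 x * N.c₁ x ≤ P₁ ∧ ∑ x, p.2 x * N.c₂ x ≤ harvest N p.1 + P₂} := by
      have := continuous_harvest N
      have hcost : IsClosed {p : (X₁ → ℝ) × (X₂ → ℝ) | ∑ x, p.1 x * N.c₁ x ≤ P₁} :=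
        isClosed_le (by fun_prop) continuous_const
      have henergy : IsClosed {p : (X₁ → ℝ) × (X₂ → ℝ) |
          ∑ x, p.2 x * N.c₂ x ≤ harvest N p.1 + P₂} :=
        isClosed_le (by fun_prop) (by fun_prop)
      exact hcost.inter henergy
    convert ((isCompact_stdSimplex ℝ X₁).prod (isCompact_stdSimplex ℝ X₂)).inter_right hcl using 1
    ext p
    simp only [K, inputs₁, inputs₂, Set.mem_ofPred_eq, Set.mem_inter_iff, Set.mem_prod]
    tauto
  obtain ⟨p₁, hp₁⟩ := inputs₁_nonempty N h₁
  obtain ⟨p₂, hp₂⟩ := inputs₂_harvest_nonempty N h₂ hp₁.1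
  have hcont : ContinuousOn (fun p : (X₁ → ℝ) × (X₂ → ℝ) => min (N.W₁.info p.1) (N.W₂.info p.2))
      K := by
    have hfst : ContinuousOn (fun p : (X₁ → ℝ) × (X₂ → ℝ) => N.W₁.info p.1) K :=
      N.W₁.continuousOn_info.comp continuousOn_fst fun p hp => hp.1.1
    exact hfst.inf (N.W₂.continuousOn_info.comp continuousOn_snd fun p hp => hp.2.1)
  obtain ⟨q, hq, hmax⟩ := hK.exists_isMaxOn ⟨(p₁, p₂), hp₁, hp₂⟩ hcont
  refine ⟨_, ⟨q.1, hq.1, rfl⟩, ?_⟩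
  rintro _ ⟨r, hr, rfl⟩
  obtain ⟨⟨s, hs, hse⟩, -⟩ := isGreatest_secondHop N (inputs₂_harvest_nonempty N h₂ hr.1)
  have h := hmax (show (r, s) ∈ K from ⟨hr, hs⟩)
  dsimp only at h ⊢
  rw [← hse]
  refine h.trans (min_le_min_left _ ?_)
  exact (isGreatest_secondHop N ⟨_, hq.2⟩).2 ⟨_, hq.2, rfl⟩

end Network

/-! ### Block codes with cost and energy guarantees for one hop -/

section Coding

variable {X Y : Type*} [Fintype X] [Fintype Y]

theorem DMC.wordProb_nonneg {X : Type*} (W : DMC X Y) {n : ℕ} (x : Fin n → X) (y : Fin n → Y) :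
    0 ≤ W.wordProb x y :=
  Finset.prod_nonneg fun _ _ => W.nonneg _ _

theorem DMC.sum_wordProb {X : Type*} (W : DMC X Y) {n : ℕ} (x : Fin n → X) :
    ∑ y, W.wordProb x y = 1 :=
  sum_prod_eq_one (fun i => W.prob (x i)) fun i => W.sum_one (x i)

theorem word_mem_stdSimplex {p : X → ℝ} (hp : p ∈ stdSimplex ℝ X) (n : ℕ) :
    (fun x : Fin n → X => ∏ i, p (x i)) ∈ stdSimplex ℝ (Fin n → X) :=
  ⟨fun _ => Finset.prod_nonneg fun _ _ => hp.1 _, sum_prod_eq_one (fun _ => p) fun _ => hp.2⟩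

theorem DMC.joint_mem_stdSimplex (W : DMC X Y) {p : X → ℝ} (hp : p ∈ stdSimplex ℝ X) :
    (fun z : X × Y => p z.1 * W.prob z.1 z.2) ∈ stdSimplex ℝ (X × Y) := by
  refine ⟨fun z => mul_nonneg (hp.1 _) (W.nonneg _ _), ?_⟩
  rw [Fintype.sum_prod_type]
  simp_rw [← Finset.mul_sum, W.sum_one, mul_one]
  exact hp.2

theorem EventuallyAbove.joint_fst (W : DMC X Y) {p f : X → ℝ} {G : ℝ}
    (h : EventuallyAbove p f G) :
    EventuallyAbove (fun z : X × Y => p z.1 * W.prob z.1 z.2) (fun z => f z.1) G := by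
  refine h.imp (fun h => h.trans_eq ?_) fun h z hz => h _ (left_ne_zero_of_mul hz)
  rw [Fintype.sum_prod_type]
  simp_rw [← Finset.sum_mul, ← Finset.mul_sum, W.sum_one, mul_one]

theorem EventuallyAbove.joint_snd (W : DMC X Y) {p : X → ℝ} (hp : ∀ x, 0 ≤ p x) {f : Y → ℝ}
    {G : ℝ} (h : EventuallyAbove (W.out p) f G) :
    EventuallyAbove (fun z : X × Y => p z.1 * W.prob z.1 z.2) (fun z => f z.2) G := by
  refine h.imp (fun h => h.trans_eq ?_) fun h z hz =>
    h _ (W.out_pos hp (left_ne_zero_of_mul hz) (right_ne_zero_of_mul hz)).ne'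
  rw [Fintype.sum_prod_type_right]
  simp_rw [← Finset.sum_mul]
  rfl

/-- Turns a threshold on the sum of densities into a likelihood-ratio test. Nonvanishing of the
factors keeps the junk value `logb 2 0 = 0` out. -/
theorem DMC.two_rpow_sum_density (W : DMC X Y) {p : X → ℝ} (hp : ∀ x, 0 ≤ p x) {n : ℕ}
    {x : Fin n → X} {y : Fin n → Y} (h : ∀ i, p (x i) * W.prob (x i) (y i) ≠ 0) :
    (2 : ℝ) ^ (∑ i, W.density p (x i) (y i)) = W.wordProb x y / ∏ i, W.out p (y i) := by
  rw [Real.rpow_sum_of_pos two_pos, DMC.wordProb, ← Finset.prod_div_distrib]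
  refine Finset.prod_congr rfl fun i _ => ?_
  have hW := right_ne_zero_of_mul (h i)
  exact Real.rpow_logb two_pos (by norm_num)
    (div_pos ((W.nonneg _ _).lt_of_ne' hW) (W.out_pos hp (left_ne_zero_of_mul (h i)) hW))

/-- Rounding the exponent up costs at most a factor 2, which the exponential gap between R and S
absorbs. -/
theorem tendsto_two_pow_div {R S : ℝ} (hR : 0 ≤ R) (hRS : R < S) :
    Tendsto (fun n : ℕ => ((2 ^ ⌈(n : ℝ) * R⌉₊ : ℕ) : ℝ) / (2 : ℝ) ^ (n * S)) atTop (𝓝 0) := by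
  have h1 : Tendsto (fun n : ℕ => 2 * ((2 : ℝ) ^ (R - S)) ^ n) atTop (𝓝 (2 * 0)) :=
    (tendsto_pow_atTop_nhds_zero_of_lt_one (by positivity)
      (Real.rpow_lt_one_of_one_lt_of_neg one_lt_two (by linarith))).const_mul 2
  rw [mul_zero] at h1
  refine tendsto_of_tendsto_of_tendsto_of_le_of_le tendsto_const_nhds h1
    (fun n => by positivity) fun n => ?_
  dsimp only
  rw [div_le_iff₀ (by positivity), ← Real.rpow_natCast ((2 : ℝ) ^ (R - S)), ← Real.rpow_mul two_pos.le,
    mul_assoc, ← Real.rpow_add two_pos]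
  push_cast
  rw [← Real.rpow_natCast 2]
  calc (2 : ℝ) ^ ((⌈(n : ℝ) * R⌉₊ : ℕ) : ℝ) ≤ 2 ^ (1 + ((R - S) * n + n * S)) := by
        refine Real.rpow_le_rpow_of_exponent_le one_le_two ?_
        have := Nat.ceil_lt_add_one (a := n * R) (by positivity)
        linarith
    _ = _ := by rw [Real.rpow_add two_pos, Real.rpow_one]

/-- Codes of every rate below `I(X;Y)` whose codewords have cost at most `G` per letter, and whose
decoding sets contain only words of energy at least `β` per letter. -/
theorem DMC.exists_block_code (W : DMC X Y) {p : X → ℝ} (hp : p ∈ stdSimplex ℝ X) {R : ℝ}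
    (hR0 : 0 ≤ R) (hR : R < W.info p) {c : X → ℝ} {G : ℝ}
    (hc : EventuallyAbove p (fun x => -c x) (-G)) {b : Y → ℝ} {β : ℝ}
    (hb : EventuallyAbove (W.out p) b β) {ε : ℝ} (hε : 0 < ε) :
    ∀ᶠ n : ℕ in atTop, ∃ (enc : Fin (2 ^ ⌈(n : ℝ) * R⌉₊) → Fin n → X)
      (D : Fin (2 ^ ⌈(n : ℝ) * R⌉₊) → Finset (Fin n → Y)),
      Pairwise (fun i j => Disjoint (D i) (D j)) ∧
      (∀ m, ∑ i, c (enc m i) ≤ n * G) ∧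
      (∀ m, ∀ y ∈ D m, n * β ≤ ∑ i, b (y i)) ∧
      ∀ m, 1 - ε ≤ ∑ y ∈ D m, W.wordProb (enc m) y := by
  classical
  -- For ε < 1 no decoding set is empty, so the cost bound inside the test passes to every codeword.
  -- Larger ε is served by the code for 1 / 2.
  wlog hε1 : ε < 1 generalizing ε
  · filter_upwards [this (ε := 1 / 2) (by norm_num) (by norm_num)] with n hn
    obtain ⟨enc, D, h1, h2, h3, h4⟩ := hn
    exact ⟨enc, D, h1, h2, h3, fun m => le_trans (by linarith) (h4 m)⟩
  obtain ⟨S, hRS, hS⟩ := exists_between hR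
  set π : X × Y → ℝ := fun z => p z.1 * W.prob z.1 z.2 with hπdef
  have hπ : π ∈ stdSimplex ℝ (X × Y) := W.joint_mem_stdSimplex hp
  have hd : EventuallyAbove π (fun z => W.density p z.1 z.2) S := by
    refine Or.inl (hS.trans_eq ?_)
    rw [W.info_eq, Fintype.sum_prod_type]
    simp_rw [Finset.mul_sum, hπdef, mul_assoc]
  have hlim := ((tendsto_lower_tail π hπ _ _ hd).add
    (tendsto_lower_tail π hπ _ _ (hc.joint_fst W))).add
    ((tendsto_lower_tail π hπ _ _ (hb.joint_snd W hp.1)).add (tendsto_two_pow_div hR0 hRS))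
  simp only [add_zero] at hlim
  filter_upwards [hlim.eventually_lt_const hε] with n hn
  let T : (Fin n → X) → (Fin n → Y) → Prop := fun x y =>
    (2 : ℝ) ^ (n * S) * ∏ i, W.out p (y i) ≤ W.wordProb x y ∧ ∑ i, c (x i) ≤ n * G ∧
      n * β ≤ ∑ i, b (y i)
  have hmass : 1 - ε + ((2 ^ ⌈(n : ℝ) * R⌉₊ : ℕ) : ℝ) / (2 : ℝ) ^ (n * S) <
      ∑ x : Fin n → X, ∑ y : Fin n → Y,
        (∏ i, p (x i)) * W.wordProb x y * if T x y then 1 else 0 := by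
    have hsplit : ∑ x : Fin n → X, ∑ y : Fin n → Y,
        (∏ i, p (x i)) * W.wordProb x y * (if T x y then 1 else 0) =
        ∑ z : Fin n → X × Y, (∏ i, π (z i)) *
          if T (fun i => (z i).1) (fun i => (z i).2) then 1 else 0 := by
      rw [← (Equiv.arrowProdEquivProdArrow (Fin n) (fun _ => X) (fun _ => Y)).symm.sum_comp,
        Fintype.sum_prod_type]
      refine Finset.sum_congr rfl fun x _ => Finset.sum_congr rfl fun y _ => ?_
      unfold DMC.wordProb
      rw [← Finset.prod_mul_distrib]
      rfl
    rw [hsplit]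
    -- Union bound: a pair of words of positive probability passes the test or lies in one of the
    -- three lower tails.
    have hle : ∑ z : Fin n → X × Y, ∏ i, π (z i) ≤
        ∑ z : Fin n → X × Y, ((∏ i, π (z i)) *
            (if T (fun i => (z i).1) (fun i => (z i).2) then 1 else 0) +
          ((∏ i, π (z i)) * (if ∑ i, W.density p (z i).1 (z i).2 < n * S then 1 else 0) +
          (∏ i, π (z i)) * (if ∑ i, -c (z i).1 < n * -G then 1 else 0) +
          (∏ i, π (z i)) * (if ∑ i, b (z i).2 < n * β then 1 else 0))) := by
      refine Finset.sum_le_sum fun z _ => ?_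
      have hz0 : 0 ≤ ∏ i, π (z i) := Finset.prod_nonneg fun i _ => hπ.1 _
      by_cases hz : ∏ i, π (z i) = 0
      · simp [hz]
      rw [← ne_eq, Finset.prod_ne_zero_iff] at hz
      by_cases h1 : ∑ i, W.density p (z i).1 (z i).2 < n * S
      · rw [if_pos h1, mul_one]
        have : ∀ P : Prop, [Decidable P] → 0 ≤ (∏ i, π (z i)) * (if P then 1 else 0) :=
          fun P _ => mul_nonneg hz0 (by split_ifs <;> simp)
        linarith [this (T (fun i => (z i).1) (fun i => (z i).2)), this (∑ i, -c (z i).1 < n * -G),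
          this (∑ i, b (z i).2 < n * β)]
      by_cases h2 : ∑ i, -c (z i).1 < n * -G
      · rw [if_pos h2, if_neg h1, mul_one, mul_zero]
        have : ∀ P : Prop, [Decidable P] → 0 ≤ (∏ i, π (z i)) * (if P then 1 else 0) :=
          fun P _ => mul_nonneg hz0 (by split_ifs <;> simp)
        linarith [this (T (fun i => (z i).1) (fun i => (z i).2)), this (∑ i, b (z i).2 < n * β)]
      by_cases h3 : ∑ i, b (z i).2 < n * β
      · rw [if_pos h3, if_neg h1, if_neg h2, mul_one, mul_zero]
        have : ∀ P : Prop, [Decidable P] → 0 ≤ (∏ i, π (z i)) * (if P then 1 else 0) :=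
          fun P _ => mul_nonneg hz0 (by split_ifs <;> simp)
        linarith [this (T (fun i => (z i).1) (fun i => (z i).2))]
      have hT : T (fun i => (z i).1) (fun i => (z i).2) := by
        refine ⟨?_, ?_, not_lt.1 h3⟩
        · have hpos : 0 < ∏ i, W.out p (z i).2 := Finset.prod_pos fun i _ =>
            W.out_pos hp.1 (left_ne_zero_of_mul (hz i (Finset.mem_univ i)))
              (right_ne_zero_of_mul (hz i (Finset.mem_univ i)))
          rw [← le_div_iff₀ hpos, ← W.two_rpow_sum_density hp.1 fun i => hz i (Finset.mem_univ i)]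
          exact Real.rpow_le_rpow_of_exponent_le one_le_two (not_lt.1 h1)
        · rw [Finset.sum_neg_distrib] at h2
          linarith
      rw [if_pos hT, if_neg h1, if_neg h2, if_neg h3]
      simp
    rw [sum_prod_eq_one (fun _ : Fin n => π) (fun _ => hπ.2)] at hle
    simp only [Finset.sum_add_distrib] at hle
    linarith
  obtain ⟨enc, D, hD, hDT, hDW⟩ := exists_maximal_code W.wordProb W.wordProb_nonneg _
    (word_mem_stdSimplex hp n) T ((2 : ℝ) ^ (n * S)) (by positivity) (fun x y hT => by
      convert hT.1 using 2
      simp_rw [DMC.wordProb, ← Finset.prod_mul_distrib]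
      unfold DMC.out
      rw [Fintype.prod_sum]) W.sum_wordProb ε
    (2 ^ ⌈(n : ℝ) * R⌉₊) (by convert hmass)
  refine ⟨enc, D, hD, fun m => ?_, fun m y hy => (hDT m y hy).2.2, hDW⟩
  have hne : (D m).Nonempty := by
    by_contra hcon
    have := hDW m
    rw [Finset.not_nonempty_iff_eq_empty.1 hcon, Finset.sum_empty] at this
    linarith
  obtain ⟨y, hy⟩ := hne
  exact (hDT m y hy).2.1

end Coding

/-! ### Single-letter converse for one hop -/

section Converse

variable {X Y A : Type*} [Fintype X] [Fintype Y] [Fintype A]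

open Classical in
/-- The pmf of the input symbol at a uniformly random time, when the input word is `u a` with
probability `w a`. -/
noncomputable def avgInput {n : ℕ} (w : A → ℝ) (u : A → Fin n → X) (x : X) : ℝ :=
  (1 / (n : ℝ)) * ∑ a, w a * ∑ i, if u a i = x then 1 else 0

theorem sum_avgInput_mul {n : ℕ} (w : A → ℝ) (u : A → Fin n → X) (F : X → ℝ) :
    ∑ x, avgInput w u x * F x = (1 / (n : ℝ)) * ∑ a, w a * ∑ i, F (u a i) := by
  simp_rw [avgInput, mul_assoc, ← Finset.mul_sum, Finset.sum_mul]
  congr 1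
  rw [Finset.sum_comm]
  refine Finset.sum_congr rfl fun a _ => ?_
  simp_rw [mul_assoc, ← Finset.mul_sum, Finset.sum_mul]
  rw [Finset.sum_comm]
  congr 1
  refine Finset.sum_congr rfl fun i _ => ?_
  rw [Finset.sum_eq_single (u a i)] <;> simp +contextual [eq_comm]

theorem avgInput_mem_stdSimplex {n : ℕ} (hn : 0 < n) {w : A → ℝ} (hw : w ∈ stdSimplex ℝ A)
    (u : A → Fin n → X) : avgInput w u ∈ stdSimplex ℝ X := by
  classical
  constructor
  · intro x
    refine mul_nonneg (by positivity) (Finset.sum_nonneg fun a _ => mul_nonneg (hw.1 a) ?_)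
    exact Finset.sum_nonneg fun i _ => by split_ifs <;> simp
  · have := sum_avgInput_mul w u fun _ => 1
    have hn' : (n : ℝ) ≠ 0 := by positivity
    simpa [← Finset.sum_mul, hw.2, hn'] using this

/-- Absolute continuity: every symbol actually sent has positive averaged probability, so the
densities below are genuine logarithms. -/
theorem avgInput_ne_zero {X : Type*} {n : ℕ} {w : A → ℝ} (hw : ∀ a, 0 ≤ w a)
    (u : A → Fin n → X) {a : A} (ha : w a ≠ 0) (i : Fin n) : avgInput w u (u a i) ≠ 0 := by
  classical
  have hn : (0 : ℝ) < n := by exact_mod_cast i.pos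
  have h0 : ∀ a', 0 ≤ ∑ j, (if u a' j = u a i then (1 : ℝ) else 0) := fun a' =>
    Finset.sum_nonneg fun j _ => by split_ifs <;> simp
  have h1 : (1 : ℝ) ≤ ∑ j, (if u a j = u a i then (1 : ℝ) else 0) := by
    have := Finset.single_le_sum (f := fun j => if u a j = u a i then (1 : ℝ) else 0)
      (fun j _ => by split_ifs <;> simp) (Finset.mem_univ i)
    simpa using this
  refine (mul_pos (by positivity) (lt_of_lt_of_le ?_
    (Finset.single_le_sum (fun a' _ => mul_nonneg (hw a') (h0 a')) (Finset.mem_univ a)))).ne'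
  exact mul_pos ((hw a).lt_of_ne' ha) (by linarith)

/-- An exact identity, with no appeal to concavity of information, because the densities refer to
the averaged output pmf at every time instead of the true output law. -/
theorem DMC.sum_wordProb_density (W : DMC X Y) {n : ℕ} (hn : 0 < n) (w : A → ℝ)
    (u : A → Fin n → X) :
    ∑ a, ∑ y, w a * W.wordProb (u a) y * ∑ i, W.density (avgInput w u) (u a i) (y i) =
      n * W.info (avgInput w u) := by
  classical
  rw [W.info_eq, sum_avgInput_mul]
  have hn' : (n : ℝ) ≠ 0 := by positivity
  rw [← mul_assoc, mul_one_div_cancel hn', one_mul]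
  refine Finset.sum_congr rfl fun a _ => ?_
  simp_rw [mul_assoc, ← Finset.mul_sum]
  congr 1
  simp_rw [Finset.mul_sum]
  rw [Finset.sum_comm]
  exact Finset.sum_congr rfl fun i _ =>
    sum_prod_apply (fun i => W.prob (u a i)) (fun i => W.sum_one _) i
      (fun y => W.density (avgInput w u) (u a i) y)

/-- If a randomized test `T` accepts with probability at most `1 / L` when the output word is
independent of `a`, then its acceptance probability is bounded by the information. -/
theorem DMC.accept_mul_logb_le (W : DMC X Y) {w : A → ℝ} (hw : w ∈ stdSimplex ℝ A) {n : ℕ}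
    (hn : 0 < n) (u : A → Fin n → X) (T : A → (Fin n → Y) → ℝ) (hT0 : ∀ a y, 0 ≤ T a y)
    (hT1 : ∀ a y, T a y ≤ 1) {L : ℝ} (hL : 0 < L) (hTL : ∀ y, ∑ a, w a * T a y ≤ 1 / L) :
    (∑ a, ∑ y, w a * W.wordProb (u a) y * T a y) * Real.logb 2 L - 1 ≤
      n * W.info (avgInput w u) := by
  set p := avgInput w u with hpdef
  have hp : p ∈ stdSimplex ℝ X := avgInput_mem_stdSimplex hn hw u
  set Q : (Fin n → Y) → ℝ := fun y => ∏ i, W.out p (y i) with hQ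
  have hQ0 : ∀ y, 0 ≤ Q y := fun y => Finset.prod_nonneg fun i _ => W.out_nonneg hp.1 _
  have hQ1 : ∑ y, Q y = 1 := sum_prod_eq_one (fun _ => W.out p) fun _ => W.sum_out hp.2
  have hlog2 : 0 < Real.log 2 := Real.log_pos one_lt_two
  -- Pointwise form of nonnegativity of relative entropy, against the reference weight w Q (1 + T L)
  -- / 2. Its total mass is at most 1 because the test accepts with probability at most 1 / L under
  -- independence. The halving costs the one bit in the conclusion.
  have hpt : ∀ a y, w a * W.wordProb (u a) y - w a * (Q y * (1 + T a y * L)) / 2 ≤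
      (w a * W.wordProb (u a) y * ∑ i, W.density p (u a i) (y i)
        - w a * W.wordProb (u a) y * T a y * Real.logb 2 L + w a * W.wordProb (u a) y) *
        Real.log 2 := by
    intro a y
    have hR0 : 0 ≤ w a * (Q y * (1 + T a y * L)) / 2 := by
      have := hw.1 a; have := hQ0 y; have := hT0 a y
      positivity
    by_cases ha : w a = 0
    · simp [ha]
    by_cases hWy : W.wordProb (u a) y = 0
    · simp only [hWy]; linarith
    have hWpos : 0 < W.wordProb (u a) y := (W.wordProb_nonneg _ _).lt_of_ne' hWy
    have hne : ∀ i, p (u a i) * W.prob (u a i) (y i) ≠ 0 := fun i =>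
      mul_ne_zero (avgInput_ne_zero hw.1 u ha i) (Finset.prod_ne_zero_iff.1 hWy i (Finset.mem_univ i))
    have hQpos : 0 < Q y := Finset.prod_pos fun i _ =>
      W.out_pos hp.1 (left_ne_zero_of_mul (hne i)) (right_ne_zero_of_mul (hne i))
    have hdens : (∑ i, W.density p (u a i) (y i)) * Real.log 2 =
        Real.log (W.wordProb (u a) y) - Real.log (Q y) := by
      rw [← Real.log_rpow two_pos, W.two_rpow_sum_density hp.1 hne, Real.log_div hWy hQpos.ne']
    have hlogb : Real.logb 2 L * Real.log 2 = Real.log L := by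
      rw [Real.logb, div_mul_cancel₀ _ hlog2.ne']
    -- Bernoulli's inequality links `L ^ T`, whose logarithm is linear in T, to a bound itself
    -- linear in T, which can be averaged with `hTL`.
    have hbern : L ^ T a y ≤ 1 + T a y * L := by
      have := rpow_one_add_le_one_add_mul_self (s := L - 1) (by linarith) (hT0 a y) (hT1 a y)
      rw [add_sub_cancel] at this
      nlinarith [hT0 a y]
    have hlog : Real.log (Q y * L ^ T a y / (2 * W.wordProb (u a) y)) =
        Real.log (Q y) + T a y * Real.log L - (Real.log 2 + Real.log (W.wordProb (u a) y)) := by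
      rw [Real.log_div (by positivity) (by positivity), Real.log_mul (by positivity) (by positivity),
        Real.log_mul (by positivity) (by positivity), Real.log_rpow hL]
    have hle := Real.log_le_sub_one_of_pos
      (show 0 < Q y * L ^ T a y / (2 * W.wordProb (u a) y) by positivity)
    rw [hlog] at hle
    have hmul := mul_le_mul_of_nonneg_left hle (mul_nonneg (hw.1 a) hWpos.le)
    have hcancel : w a * W.wordProb (u a) y * (Q y * L ^ T a y / (2 * W.wordProb (u a) y) - 1) =
        w a * (Q y * L ^ T a y) / 2 - w a * W.wordProb (u a) y := by
      field_simp
    rw [hcancel] at hmul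
    have hmono : w a * (Q y * L ^ T a y) / 2 ≤ w a * (Q y * (1 + T a y * L)) / 2 := by
      have := hw.1 a
      gcongr
    calc _ ≤ w a * W.wordProb (u a) y - w a * (Q y * L ^ T a y) / 2 := by linarith
      _ ≤ w a * W.wordProb (u a) y * ((∑ i, W.density p (u a i) (y i)) * Real.log 2
          - T a y * (Real.logb 2 L * Real.log 2) + Real.log 2) := by
        rw [hdens, hlogb]
        linarith
      _ = _ := by ring
  have hsum := Finset.sum_le_sum fun a (_ : a ∈ Finset.univ) =>
    Finset.sum_le_sum fun y (_ : y ∈ Finset.univ) => hpt a y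
  simp_rw [← Finset.sum_mul, Finset.sum_add_distrib, Finset.sum_sub_distrib] at hsum
  rw [W.sum_wordProb_density hn w u] at hsum
  simp_rw [← Finset.mul_sum, W.sum_wordProb, mul_one, hw.2] at hsum
  have hright : ∑ a, ∑ y, w a * (Q y * (1 + T a y * L)) / 2 ≤ 1 := by
    rw [Finset.sum_comm]
    calc ∑ y, ∑ a, w a * (Q y * (1 + T a y * L)) / 2
        = ∑ y, Q y * ((∑ a, w a + L * ∑ a, w a * T a y) / 2) := by
          refine Finset.sum_congr rfl fun y _ => ?_
          rw [Finset.mul_sum, ← Finset.sum_add_distrib, Finset.sum_div, Finset.mul_sum]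
          exact Finset.sum_congr rfl fun a _ => by ring
      _ ≤ ∑ y, Q y * 1 := by
          gcongr with y
          · exact hQ0 y
          · have := mul_le_mul_of_nonneg_left (hTL y) hL.le
            rw [mul_one_div_cancel hL.ne'] at this
            rw [hw.2]
            linarith
      _ = 1 := by simp [hQ1]
  have h0 : 0 ≤ (n * W.info p - (∑ a, ∑ y, w a * W.wordProb (u a) y * T a y) * Real.logb 2 L + 1)
      * Real.log 2 := by
    simp only [← Finset.sum_mul] at hsum ⊢
    linarith
  have := nonneg_of_mul_nonneg_left h0 hlog2
  linarith

end Converse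

/-! ### Cutting sequences into blocks -/

section Blocks

/-- The `t`-th block of length `l` of a sequence. -/
def block {Y : Type*} (l : ℕ) (y : ℕ → Y) (t : ℕ) : Fin l → Y :=
  fun o => y (t * l + o)

/-- The sequence with the given blocks. -/
def join {X : Type*} {l : ℕ} (hl : 0 < l) (c : ℕ → Fin l → X) (i : ℕ) : X :=
  c (i / l) ⟨i % l, Nat.mod_lt i hl⟩

theorem join_mul_add {X : Type*} {l : ℕ} (hl : 0 < l) (c : ℕ → Fin l → X) (t : ℕ) (o : Fin l) :
    join hl c (t * l + o) = c t o := by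
  have h1 : (t * l + o) / l = t := by
    rw [mul_comm, Nat.mul_add_div hl, Nat.div_eq_of_lt o.isLt, add_zero]
  have h2 : (t * l + o) % l = o := by
    rw [mul_comm, Nat.mul_add_mod, Nat.mod_eq_of_lt o.isLt]
  have h3 : (⟨(t * l + o) % l, Nat.mod_lt _ hl⟩ : Fin l) = o := Fin.ext h2
  rw [join, h1, h3]

theorem sum_range_mul {l : ℕ} (F : ℕ → ℝ) (T : ℕ) :
    ∑ i ∈ Finset.range (T * l), F i = ∑ t ∈ Finset.range T, ∑ o : Fin l, F (t * l + o) := by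
  induction T with
  | zero => simp
  | succ T ih =>
    rw [Finset.sum_range_succ, ← ih, add_mul, one_mul, Finset.sum_range_add,
      Finset.sum_range fun o => F (T * l + o)]

theorem sum_range_eq_blocks {l T n : ℕ} (h : T * l ≤ n) (F : ℕ → ℝ) :
    ∑ i ∈ Finset.range n, F i =
      ∑ t ∈ Finset.range T, ∑ o : Fin l, F (t * l + o) + ∑ i ∈ Finset.Ico (T * l) n, F i := by
  rw [← sum_range_mul, Finset.sum_range_add_sum_Ico _ h]

/-- The extension of a word to a sequence. -/
def extend {Y : Type*} {n : ℕ} (d : Y) (y : Fin n → Y) (j : ℕ) : Y :=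
  if h : j < n then y ⟨j, h⟩ else d

/-- The positions of the `t`-th block of length `l`. -/
def position {l n t : ℕ} (h : (t + 1) * l ≤ n) (o : Fin l) : Fin n :=
  ⟨t * l + o, by have := o.isLt; rw [add_mul, one_mul] at h; omega⟩

theorem position_injective {l n t : ℕ} (h : (t + 1) * l ≤ n) :
    Function.Injective (position h) := by
  intro o o' hoo
  have := congrArg Fin.val hoo
  simp only [position] at this
  exact Fin.ext (by omega)

theorem block_extend {Y : Type*} {l n t : ℕ} (h : (t + 1) * l ≤ n) (d : Y) (y : Fin n → Y) :
    block l (extend d y) t = y ∘ position h := by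
  funext o
  exact dif_pos (position h o).isLt

open Classical in
/-- The message whose decoding set contains `z`, if there is one. -/
noncomputable def decodeSet {M : ℕ} {Z : Type*} (D : Fin M → Finset Z) (z : Z) :
    Option (Fin M) :=
  if h : ∃ m, z ∈ D m then some h.choose else none

theorem decodeSet_eq_some {M : ℕ} {Z : Type*} {D : Fin M → Finset Z}
    (hD : Pairwise fun i j => Disjoint (D i) (D j)) {z : Z} {m : Fin M} (h : z ∈ D m) :
    decodeSet D z = some m := by
  have hex : ∃ m, z ∈ D m := ⟨m, h⟩
  rw [decodeSet, dif_pos hex]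
  by_contra hne
  exact Finset.disjoint_left.1 (hD fun he => hne (congrArg some he)) hex.choose_spec h

theorem mem_of_decodeSet_isSome {M : ℕ} {Z : Type*} {D : Fin M → Finset Z} {z : Z}
    (h : (decodeSet D z).isSome) : ∃ m, z ∈ D m := by
  by_contra hcon
  simp [decodeSet, hcon] at h

end Blocks

/-! ### The relay's strategy and its energy balance -/

section Relay

variable {X₁ Y₁ X₂ Y₂ : Type*} {l M : ℕ}

open Classical in
/-- The relay's word in block `t`: the codeword of the message decoded from the previous block,
provided that all the previous blocks were decoded; otherwise the idle symbol `x₀`. -/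
noncomputable def relayBlock (K : ℕ) (D : Fin M → Finset (Fin l → Y₁)) (enc : Fin M → Fin l → X₂)
    (x₀ : X₂) (y : ℕ → Y₁) : ℕ → Fin l → X₂
  | 0 => fun _ => x₀
  | t + 1 =>
    if t < K ∧ ∀ s ≤ t, (decodeSet D (block l y s)).isSome then
      (decodeSet D (block l y t)).elim (fun _ => x₀) enc
    else fun _ => x₀

theorem relayBlock_congr (K : ℕ) (D : Fin M → Finset (Fin l → Y₁)) (enc : Fin M → Fin l → X₂)
    (x₀ : X₂) {y y' : ℕ → Y₁} {t : ℕ} (h : ∀ j < t * l, y j = y' j) :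
    relayBlock K D enc x₀ y t = relayBlock K D enc x₀ y' t := by
  cases t with
  | zero => rfl
  | succ t =>
    have hs : ∀ s ≤ t, block l y s = block l y' s := fun s hs => by
      funext o
      refine h _ ?_
      have : (s + 1) * l ≤ (t + 1) * l := by gcongr
      have := o.isLt
      rw [add_mul s, one_mul] at *
      omega
    have hiff : (∀ s ≤ t, (decodeSet D (block l y s)).isSome = true) ↔
        ∀ s ≤ t, (decodeSet D (block l y' s)).isSome = true :=
      forall₂_congr fun s h => by rw [hs s h]
    simp only [relayBlock, hs t le_rfl, hiff]

theorem relayBlock_eq_idle {K : ℕ} (D : Fin M → Finset (Fin l → Y₁)) (enc : Fin M → Fin l → X₂)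
    (x₀ : X₂) (y : ℕ → Y₁) {t : ℕ} (h : K < t) :
    relayBlock K D enc x₀ y t = fun _ => x₀ := by
  cases t with
  | zero => rfl
  | succ t => rw [relayBlock, if_neg fun h' => by omega]

/-- The energy surplus of the relay in block `t`. -/
noncomputable def surplus (b : Y₁ → ℝ) (c : X₂ → ℝ) (P : ℝ) (f : ℕ → Fin l → X₂) (y : ℕ → Y₁)
    (t : ℕ) : ℝ :=
  ∑ o, (b (block l y t o) + P - c (f t o))

/-- The relay never runs out of energy at the end of a block. -/
theorem sum_surplus_nonneg {b : Y₁ → ℝ} {c : X₂ → ℝ} {P bm β : ℝ} {x₀ : X₂}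
    (hbm : ∀ y, bm ≤ b y) (hx₀ : c x₀ ≤ bm + P) (hβ : bm ≤ β) (K : ℕ)
    {D : Fin M → Finset (Fin l → Y₁)} (hD : ∀ m, ∀ z ∈ D m, l * β ≤ ∑ o, b (z o))
    {enc : Fin M → Fin l → X₂} (henc : ∀ m, ∑ o, c (enc m o) ≤ l * (β + P)) (y : ℕ → Y₁) (T : ℕ) :
    0 ≤ ∑ t ∈ Finset.range T, surplus b c P (relayBlock K D enc x₀ y) y t := by
  set f := relayBlock K D enc x₀ y with hf
  have hsur : ∀ t, surplus b c P f y t =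
      ∑ o, b (block l y t o) + l * P - ∑ o, c (f t o) := fun t => by
    simp [surplus, Finset.sum_sub_distrib, Finset.sum_add_distrib]
  have hlow : ∀ t, l * bm ≤ ∑ o, b (block l y t o) := fun t => by
    have := Finset.sum_le_sum fun o (_ : o ∈ Finset.univ) => hbm (block l y t o)
    simpa using this
  have hgood : ∀ t, (decodeSet D (block l y t)).isSome → l * β ≤ ∑ o, b (block l y t o) :=
    fun t ht => by
      obtain ⟨m, hm⟩ := mem_of_decodeSet_isSome ht
      exact hD m _ hm
  have hl0 : (0 : ℝ) ≤ l := Nat.cast_nonneg l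
  have hE : 0 ≤ l * (β - bm) := mul_nonneg hl0 (sub_nonneg.2 hβ)
  have hidle : ∀ t, f t = (fun _ => x₀) → ∑ o, c (f t o) ≤ l * (bm + P) := fun t ht => by
    rw [ht]
    simpa using mul_le_mul_of_nonneg_left hx₀ hl0
  -- The induction carries a reserve: as long as all blocks were decoded, `l * (β - bm)` is in
  -- store. A codeword costs at most `l * (β + P)` while at least `l * bm` is harvested, so the
  -- reserve just covers it. If the current block is decoded too, it pays for itself and the reserve
  -- stays; if not, the relay idles from then on, never at a loss.
  have key : 0 ≤ ∑ t ∈ Finset.range T, surplus b c P f y t ∧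
      (1 ≤ T → T ≤ K + 1 → (∀ s < T, (decodeSet D (block l y s)).isSome) →
        l * (β - bm) ≤ ∑ t ∈ Finset.range T, surplus b c P f y t) := by
    induction T with
    | zero => simp
    | succ t ih =>
      rw [Finset.sum_range_succ, hsur]
      obtain ⟨ih0, ih1⟩ := ih
      by_cases hcond : ∃ t', t = t' + 1 ∧ t' < K ∧
          ∀ s ≤ t', (decodeSet D (block l y s)).isSome
      · obtain ⟨t', rfl, htK, hdec⟩ := hcond
        have h1 := ih1 (by omega) (by omega) fun s hs => hdec s (by omega)
        obtain ⟨m, hm⟩ := Option.isSome_iff_exists.1 (hdec t' le_rfl)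
        have hft : f (t' + 1) = enc m := by
          simp only [hf, relayBlock]
          rw [if_pos ⟨htK, hdec⟩, hm]
          rfl
        have hcost := henc m
        rw [← hft] at hcost
        refine ⟨?_, fun _ _ hall => ?_⟩
        · linarith [hlow (t' + 1)]
        · linarith [hgood (t' + 1) (hall _ (by omega))]
      · have hft : f t = fun _ => x₀ := by
          cases t with
          | zero => rfl
          | succ t' =>
            simp only [hf, relayBlock]
            rw [if_neg fun h => hcond ⟨t', rfl, h⟩]
        have hcost := hidle t hft
        refine ⟨by linarith [hlow t], fun _ htK hall => ?_⟩
        have := hgood t (hall t (by omega))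
        linarith
  exact key.1

end Relay

/-! ### The block Markov code and its error probability -/

section Composite

/-- By memorylessness, the outputs at the positions `e` follow the channel law of the subword `x ∘
e`, so the error bound of a block code survives inside the long word. -/
theorem DMC.sum_miss_le {X Y : Type*} [Fintype Y] (W : DMC X Y) {l n : ℕ} (e : Fin l → Fin n)
    (he : Function.Injective e) (x : Fin n → X) (D : Finset (Fin l → Y)) {ε : ℝ}
    (hD : 1 - ε ≤ ∑ z ∈ D, W.wordProb (x ∘ e) z)
    [DecidablePred fun y : Fin n → Y => y ∘ e ∈ D] :
    ∑ y, W.wordProb x y * (if y ∘ e ∈ D then 0 else 1) ≤ ε := by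
  classical
  have h := sum_prod_comp e he (fun i => W.prob (x i)) (fun i => W.sum_one _)
    (fun z => if z ∈ D then (0 : ℝ) else 1)
  have h1 := W.sum_wordProb (x ∘ e)
  rw [← Finset.sum_add_sum_compl D] at h1
  have h2 : ∑ z, W.wordProb (x ∘ e) z * (if z ∈ D then 0 else 1) =
      ∑ z ∈ Dᶜ, W.wordProb (x ∘ e) z := by
    rw [← Finset.sum_add_sum_compl D, Finset.sum_eq_zero fun z hz => by simp [hz], zero_add]
    exact Finset.sum_congr rfl fun z hz => by simp [Finset.mem_compl.1 hz]
  calc _ = ∑ z, W.wordProb (x ∘ e) z * (if z ∈ D then 0 else 1) := by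
        unfold DMC.wordProb
        convert h
        rfl
    _ ≤ ε := by linarith

variable {X₁ Y₁ X₂ Y₂ : Type*} [Fintype Y₁] [Fintype Y₂]

/-- Block Markov coding: block codes for the two hops, with `K` message blocks, give a code for
the two-hop channel with a harvesting relay. -/
theorem exists_code_of_block_codes (N : Network X₁ Y₁ X₂ Y₂) {P₁ P₂ bm β ε : ℝ} (hε : 0 ≤ ε)
    {x₁ : X₁} (hx₁ : N.c₁ x₁ ≤ P₁) {x₀ : X₂} {y₀ : Y₁}
    (hbm : ∀ y, bm ≤ N.b y) (hx₀ : N.c₂ x₀ ≤ bm + P₂) (hβ : bm ≤ β)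
    {l M₀ K n M : ℕ} (hl : 0 < l) (hM₀ : 0 < M₀) (hM : 0 < M) (hn : (K + 1) * l ≤ n)
    (hMK : M ≤ M₀ ^ K)
    {enc₁ : Fin M₀ → Fin l → X₁} {D₁ : Fin M₀ → Finset (Fin l → Y₁)}
    (hD₁ : Pairwise fun i j => Disjoint (D₁ i) (D₁ j))
    (hcost₁ : ∀ m, ∑ o, N.c₁ (enc₁ m o) ≤ l * P₁)
    (hharvest : ∀ m, ∀ z ∈ D₁ m, l * β ≤ ∑ o, N.b (z o))
    (herr₁ : ∀ m, 1 - ε ≤ ∑ z ∈ D₁ m, N.W₁.wordProb (enc₁ m) z)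
    {enc₂ : Fin M₀ → Fin l → X₂} {D₂ : Fin M₀ → Finset (Fin l → Y₂)}
    (hD₂ : Pairwise fun i j => Disjoint (D₂ i) (D₂ j))
    (hcost₂ : ∀ m, ∑ o, N.c₂ (enc₂ m o) ≤ l * (β + P₂))
    (herr₂ : ∀ m, 1 - ε ≤ ∑ z ∈ D₂ m, N.W₂.wordProb (enc₂ m) z) :
    ∃ C : Code N P₁ P₂ M n, C.errorProb ≤ 2 * K * ε := by
  classical
  have hn0 : 0 < n := lt_of_lt_of_le (by positivity) hn
  have hn0' : (0 : ℝ) < n := Nat.cast_pos.2 hn0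
  have : Nonempty (Fin M) := ⟨⟨0, hM⟩⟩
  obtain ⟨φ⟩ : Nonempty (Fin M ↪ (Fin K → Fin M₀)) :=
    Function.Embedding.nonempty_of_card_le (by simpa using hMK)
  have hpos : ∀ t ≤ K, (t + 1) * l ≤ n := fun t ht => le_trans (by gcongr) hn
  let cw : Fin M → ℕ → Fin l → X₁ := fun m t =>
    if h : t < K then enc₁ (φ m ⟨t, h⟩) else fun _ => x₁
  let f : (ℕ → Y₁) → ℕ → X₂ := fun y => join hl (relayBlock K D₁ enc₂ x₀ y)
  -- Time i lies in block i / l, whose word uses only letters before (i / l) * l ≤ i. Hence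
  -- extending the past by the dummy letter `y₀` does not affect the relay.
  have hcausal : ∀ (y y' : ℕ → Y₁) (i : ℕ), (∀ j < i, y j = y' j) → f y i = f y' i := by
    intro y y' i h
    refine congrFun (relayBlock_congr K D₁ enc₂ x₀ fun j hj => h j ?_) _
    exact hj.trans_le (Nat.div_mul_le_self i l)
  let enc : Fin M → Fin n → X₁ := fun m i => join hl (cw m) i
  let relay : (i : Fin n) → (Fin (i : ℕ) → Y₁) → X₂ := fun i z => f (extend y₀ z) i
  -- Sub-message s reaches the destination one block late, in block s + 1.
  let dec : (Fin n → Y₂) → Fin M := fun y => Function.invFun φ fun s : Fin K =>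
    (decodeSet D₂ (y ∘ position (hpos (s + 1) s.isLt))).getD ⟨0, hM₀⟩
  have hrelay : ∀ (y : Fin n → Y₁) (i : Fin n), relayWord relay y i = f (extend y₀ y) i := by
    intro y i
    refine hcausal _ _ _ fun j hj => ?_
    simp [extend, hj, hj.trans i.isLt]
  refine ⟨⟨enc, relay, dec, fun m => ?_, fun m y _ => ?_⟩, ?_⟩
  · rw [one_div, inv_mul_le_iff₀ hn0', Finset.sum_fin_eq_sum_range,
      Finset.sum_congr rfl (g := fun i => N.c₁ (join hl (cw m) i))
        fun i hi => dif_pos (Finset.mem_range.1 hi), sum_range_eq_blocks hn]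
    have h1 : ∀ t ∈ Finset.range (K + 1), ∑ o : Fin l, N.c₁ (join hl (cw m) (t * l + o)) ≤
        l * P₁ := by
      intro t _
      simp_rw [join_mul_add]
      by_cases ht : t < K
      · simpa [cw, ht] using hcost₁ _
      · simpa [cw, ht] using mul_le_mul_of_nonneg_left hx₁ (Nat.cast_nonneg l)
    have h2 : ∀ i ∈ Finset.Ico ((K + 1) * l) n, N.c₁ (join hl (cw m) i) ≤ P₁ := by
      intro i hi
      have : ¬ i / l < K := not_lt.2 ((Nat.le_div_iff_mul_le hl).2
        (le_trans (by gcongr; omega) (Finset.mem_Ico.1 hi).1))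
      simpa [join, cw, this] using hx₁
    have h1' := Finset.sum_le_sum h1
    have h2' := Finset.sum_le_sum h2
    simp only [Finset.sum_const, Finset.card_range, Nat.card_Ico, nsmul_eq_mul] at h1' h2'
    rw [Nat.cast_sub hn] at h2'
    push_cast at h1' h2'
    linarith
  · set Y := extend y₀ y with hY
    have hYi : ∀ i : Fin n, N.b (y i) = N.b (Y i) := fun i => by simp [hY, extend]
    have hmain : 0 ≤ ∑ i ∈ Finset.range n, (N.b (Y i) + P₂ - N.c₂ (f Y i)) := by
      rw [sum_range_eq_blocks hn]
      refine add_nonneg ?_ (Finset.sum_nonneg fun i hi => ?_)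
      · have := sum_surplus_nonneg hbm hx₀ hβ K hharvest hcost₂ Y (K + 1)
        simpa only [surplus, block, f, join_mul_add] using this
      · have hK : K < i / l := (Nat.le_div_iff_mul_le hl).2 (Finset.mem_Ico.1 hi).1
        simp only [f, join]
        rw [relayBlock_eq_idle _ _ _ _ hK]
        linarith [hbm (Y i)]
    rw [Finset.sum_range (fun i => N.b (Y i) + P₂ - N.c₂ (f Y i))] at hmain
    simp_rw [hrelay, hYi]
    rw [Finset.sum_sub_distrib, Finset.sum_add_distrib] at hmain
    simp only [Finset.sum_const, Finset.card_univ, Fintype.card_fin, nsmul_eq_mul] at hmain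
    rw [one_div, inv_mul_le_iff₀ hn0', mul_add, mul_inv_cancel_left₀ hn0'.ne']
    linarith
  · have hmsg : ∀ m, ∑ y₁ : Fin n → Y₁, ∑ y₂ : Fin n → Y₂,
        (if dec y₂ ≠ m then
          N.W₁.wordProb (enc m) y₁ * N.W₂.wordProb (relayWord relay y₁) y₂ else 0) ≤
        2 * K * ε := by
      intro m
      let a : Fin K → (Fin n → Y₁) → ℝ := fun s y =>
        if y ∘ position (hpos s s.isLt.le) ∈ D₁ (φ m s) then 0 else 1
      let d : Fin K → (Fin n → Y₂) → ℝ := fun s y =>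
        if y ∘ position (hpos (s + 1) s.isLt) ∈ D₂ (φ m s) then 0 else 1
      have ha0 : ∀ s y, 0 ≤ a s y := fun s y => by simp only [a]; split_ifs <;> simp
      have hd0 : ∀ s y, 0 ≤ d s y := fun s y => by simp only [d]; split_ifs <;> simp
      have ha : ∀ s, ∑ y, N.W₁.wordProb (enc m) y * a s y ≤ ε := by
        intro s
        refine N.W₁.sum_miss_le _ (position_injective _) _ _ ?_
        convert herr₁ (φ m s) using 3
        funext o
        have := join_mul_add hl (cw m) s o
        simp only [cw, s.isLt, dif_pos] at this
        exact this
      have hdec : ∀ y₂, (if dec y₂ ≠ m then (1 : ℝ) else 0) ≤ ∑ s, d s y₂ := by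
        intro y₂
        by_cases hall : ∀ s : Fin K, y₂ ∘ position (hpos (s + 1) s.isLt) ∈ D₂ (φ m s)
        · have : dec y₂ = m := by
            have hφ : (fun s : Fin K => (decodeSet D₂
                (y₂ ∘ position (hpos (s + 1) s.isLt))).getD ⟨0, hM₀⟩) = φ m := by
              funext s
              rw [decodeSet_eq_some hD₂ (hall s)]
              rfl
            simp only [dec, hφ]
            exact Function.leftInverse_invFun φ.injective m
          rw [if_neg (not_not.2 this)]
          exact Finset.sum_nonneg fun s _ => hd0 s y₂
        · push Not at hall
          obtain ⟨s, hs⟩ := hall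
          have := Finset.single_le_sum (f := fun s => d s y₂) (fun s _ => hd0 s y₂)
            (Finset.mem_univ s)
          have hs1 : d s y₂ = 1 := if_neg hs
          refine le_trans ?_ this
          simp only [hs1]
          split_ifs <;> simp
      -- After a first-hop miss the sum of the `a s y₁` is at least 1 and covers any error. Without
      -- one, the relay sends the intended codewords, and each of the K second-hop blocks fails with
      -- probability at most ε.
      have hinner : ∀ y₁ : Fin n → Y₁, ∑ y₂ : Fin n → Y₂,
          (if dec y₂ ≠ m then N.W₂.wordProb (relayWord relay y₁) y₂ else 0) ≤
          ∑ s, a s y₁ + K * ε := by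
        intro y₁
        by_cases hall : ∀ s : Fin K, y₁ ∘ position (hpos s s.isLt.le) ∈ D₁ (φ m s)
        · have hdecode : ∀ s : Fin K, decodeSet D₁ (block l (extend y₀ y₁) s) = some (φ m s) :=
            fun s => by
              rw [block_extend (hpos s s.isLt.le)]
              exact decodeSet_eq_some hD₁ (hall s)
          have hword : ∀ s : Fin K,
              relayWord relay y₁ ∘ position (hpos (s + 1) s.isLt) = enc₂ (φ m s) := by
            intro s
            funext o
            simp only [Function.comp, hrelay]
            have := join_mul_add hl (relayBlock K D₁ enc₂ x₀ (extend y₀ y₁)) (s + 1) o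
            refine this.trans ?_
            have hall' : ∀ s' ≤ (s : ℕ),
                (decodeSet D₁ (block l (extend y₀ y₁) s')).isSome := fun s' hs' => by
              rw [hdecode ⟨s', hs'.trans_lt s.isLt⟩]
              rfl
            rw [relayBlock, if_pos ⟨s.isLt, hall'⟩, hdecode s]
            rfl
          calc ∑ y₂ : Fin n → Y₂,
                (if dec y₂ ≠ m then N.W₂.wordProb (relayWord relay y₁) y₂ else 0)
              ≤ ∑ y₂ : Fin n → Y₂, ∑ s, N.W₂.wordProb (relayWord relay y₁) y₂ * d s y₂ := by
                refine Finset.sum_le_sum fun y₂ _ => ?_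
                rw [← Finset.mul_sum]
                have := mul_le_mul_of_nonneg_left (hdec y₂)
                  (N.W₂.wordProb_nonneg (relayWord relay y₁) y₂)
                simpa only [mul_ite, mul_one, mul_zero] using this
            _ = ∑ s, ∑ y₂ : Fin n → Y₂, N.W₂.wordProb (relayWord relay y₁) y₂ * d s y₂ :=
                Finset.sum_comm
            _ ≤ ∑ s : Fin K, ε := by
                refine Finset.sum_le_sum fun s _ => ?_
                refine N.W₂.sum_miss_le _ (position_injective _) _ _ ?_
                rw [hword s]
                exact herr₂ (φ m s)
            _ ≤ ∑ s, a s y₁ + K * ε := by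
                have := Finset.sum_nonneg fun s (_ : s ∈ Finset.univ) => ha0 s y₁
                simpa using this
        · push Not at hall
          obtain ⟨s, hs⟩ := hall
          have h1 := Finset.single_le_sum (f := fun s => a s y₁) (fun s _ => ha0 s y₁)
            (Finset.mem_univ s)
          have hs1 : a s y₁ = 1 := if_neg hs
          simp only [hs1] at h1
          calc ∑ y₂ : Fin n → Y₂,
                (if dec y₂ ≠ m then N.W₂.wordProb (relayWord relay y₁) y₂ else 0)
              ≤ ∑ y₂ : Fin n → Y₂, N.W₂.wordProb (relayWord relay y₁) y₂ := by
                refine Finset.sum_le_sum fun y₂ _ => ?_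
                have := N.W₂.wordProb_nonneg (relayWord relay y₁) y₂
                split_ifs <;> simp [this]
            _ = 1 := N.W₂.sum_wordProb _
            _ ≤ _ := h1.trans (le_add_of_nonneg_right (by positivity))
      calc ∑ y₁ : Fin n → Y₁, ∑ y₂ : Fin n → Y₂,
            (if dec y₂ ≠ m then
              N.W₁.wordProb (enc m) y₁ * N.W₂.wordProb (relayWord relay y₁) y₂ else 0)
          = ∑ y₁ : Fin n → Y₁, N.W₁.wordProb (enc m) y₁ * ∑ y₂ : Fin n → Y₂,
            (if dec y₂ ≠ m then N.W₂.wordProb (relayWord relay y₁) y₂ else 0) := by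
            simp only [Finset.mul_sum, mul_ite, mul_zero]
        _ ≤ ∑ y₁ : Fin n → Y₁, N.W₁.wordProb (enc m) y₁ * (∑ s, a s y₁ + K * ε) :=
            Finset.sum_le_sum fun y₁ _ =>
              mul_le_mul_of_nonneg_left (hinner y₁) (N.W₁.wordProb_nonneg _ _)
        _ = ∑ s, ∑ y₁ : Fin n → Y₁, N.W₁.wordProb (enc m) y₁ * a s y₁ + K * ε := by
            simp_rw [mul_add, Finset.sum_add_distrib, ← Finset.sum_mul, N.W₁.sum_wordProb,
              Finset.mul_sum, one_mul]
            rw [Finset.sum_comm]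
        _ ≤ ∑ s : Fin K, ε + K * ε := by gcongr with s; exact ha s
        _ = 2 * K * ε := by simp; ring
    unfold Code.errorProb
    have hMpos : (0 : ℝ) < M := Nat.cast_pos.2 hM
    rw [one_div, inv_mul_le_iff₀ hMpos]
    have := Finset.sum_le_sum fun m (_ : m ∈ Finset.univ) => hmsg m
    simp only [Finset.sum_const, Finset.card_univ, Fintype.card_fin, nsmul_eq_mul] at this
    convert this

end Composite

/-! ### Achievability of all rates below the maximum -/

section Achievability

/-- A pmf with mean cost at most `G` is a limit of pmfs that either have mean cost less than `G`
or are supported on the cheapest symbols. -/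
theorem exists_tendsto_cheaper {X : Type*} [Fintype X] {p c : X → ℝ} (hp : p ∈ stdSimplex ℝ X)
    {x₀ : X} (hmin : ∀ x, c x₀ ≤ c x) {G : ℝ} (hG : ∑ x, p x * c x ≤ G) :
    ∃ q : ℕ → X → ℝ, (∀ k, q k ∈ stdSimplex ℝ X) ∧ Tendsto q atTop (𝓝 p) ∧
      ((∀ k, ∑ x, q k x * c x < G) ∨ ∀ k x, q k x ≠ 0 → c x ≤ c x₀) := by
  classical
  let θ : ℕ → ℝ := fun k => 1 / ((k : ℝ) + 1)
  have hθ0 : ∀ k, 0 < θ k := fun k => by positivity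
  have hθ1 : ∀ k, θ k ≤ 1 := fun k => by
    simp only [θ]
    rw [div_le_one (by positivity)]
    linarith [Nat.cast_nonneg (α := ℝ) k]
  have hsingle : ∑ x, (Pi.single x₀ 1 : X → ℝ) x * c x = c x₀ := by simp [Pi.single_apply]
  have hpc : c x₀ ≤ ∑ x, p x * c x := by
    calc c x₀ = ∑ x, p x * c x₀ := by rw [← Finset.sum_mul, hp.2, one_mul]
      _ ≤ _ := by
        gcongr with x
        · exact hp.1 x
        · exact hmin x
  -- Mixing in the cheapest symbol gives strict slack if `c x₀ < G`. Otherwise `c x₀` is at least G,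
  -- hence at least the mean cost, which forces p onto symbols of least cost.
  refine ⟨fun k => (1 - θ k) • p + θ k • Pi.single x₀ 1, fun k => ?_, ?_, ?_⟩
  · exact convex_stdSimplex ℝ X hp (single_mem_stdSimplex ℝ x₀) (by linarith [hθ1 k]) (hθ0 k).le
      (by ring)
  · have hθ : Tendsto θ atTop (𝓝 0) := tendsto_one_div_add_atTop_nhds_zero_nat
    simpa using (((tendsto_const_nhds (x := (1 : ℝ))).sub hθ).smul_const p).add
      (hθ.smul_const (Pi.single x₀ 1 : X → ℝ))
  · have hcost : ∀ k, ∑ x, ((1 - θ k) • p + θ k • (Pi.single x₀ 1 : X → ℝ)) x * c x =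
        (1 - θ k) * ∑ x, p x * c x + θ k * c x₀ := by
      intro k
      simp only [Pi.add_apply, Pi.smul_apply, smul_eq_mul, add_mul, Finset.sum_add_distrib,
        mul_assoc, ← Finset.mul_sum]
      rw [hsingle]
    by_cases hlt : c x₀ < G
    · left
      intro k
      rw [hcost]
      nlinarith [hθ0 k, hθ1 k, mul_le_mul_of_nonneg_left hG (sub_nonneg.2 (hθ1 k)),
        mul_lt_mul_of_pos_left hlt (hθ0 k)]
    · right
      intro k x hx
      by_cases hpx : p x = 0
      · have : x = x₀ := by
          by_contra hne
          simp [hpx, hne] at hx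
        rw [this]
      · have hzero : ∑ x, p x * (c x - c x₀) = 0 := by
          simp only [mul_sub, Finset.sum_sub_distrib, ← Finset.sum_mul, hp.2]
          linarith
        rw [Finset.sum_eq_zero_iff_of_nonneg fun x _ =>
          mul_nonneg (hp.1 x) (sub_nonneg.2 (hmin x))] at hzero
        have := (mul_eq_zero.1 (hzero x (Finset.mem_univ x))).resolve_left hpx
        linarith

theorem DMC.tendsto_info {X Y : Type*} [Fintype X] [Fintype Y] (W : DMC X Y) {p : X → ℝ}
    (hp : p ∈ stdSimplex ℝ X) {q : ℕ → X → ℝ} (hq : ∀ k, q k ∈ stdSimplex ℝ X)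
    (h : Tendsto q atTop (𝓝 p)) : Tendsto (fun k => W.info (q k)) atTop (𝓝 (W.info p)) :=
  (W.continuousOn_info p hp).tendsto.comp
    (tendsto_nhdsWithin_iff.2 ⟨h, Eventually.of_forall hq⟩)

theorem eventuallyAbove_neg {X : Type*} [Fintype X] {p c : X → ℝ} {G : ℝ}
    (h : ∑ x, p x * c x < G ∨ ∀ x, p x ≠ 0 → c x ≤ G) :
    EventuallyAbove p (fun x => -c x) (-G) := by
  refine h.imp (fun h => ?_) fun h x hx => neg_le_neg (h x hx)
  simpa [Finset.sum_neg_distrib] using h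

variable {X₁ Y₁ X₂ Y₂ : Type*} [Fintype Y₁] [Fintype Y₂]

theorem sum_out_mul_eq_harvest [Fintype X₁] (N : Network X₁ Y₁ X₂ Y₂) (p : X₁ → ℝ) :
    ∑ y, N.W₁.out p y * N.b y = harvest N p := by
  unfold harvest DMC.out
  rw [Finset.sum_comm]
  simp_rw [Finset.sum_mul]

theorem Code.errorProb_nonneg {N : Network X₁ Y₁ X₂ Y₂} {P₁ P₂ : ℝ} {M n : ℕ}
    (C : Code N P₁ P₂ M n) : 0 ≤ C.errorProb := by
  refine mul_nonneg (by positivity) (Finset.sum_nonneg fun m _ => Finset.sum_nonneg fun y₁ _ =>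
    Finset.sum_nonneg fun y₂ _ => ?_)
  split_ifs
  · exact mul_nonneg (N.W₁.wordProb_nonneg _ _) (N.W₂.wordProb_nonneg _ _)
  · exact le_rfl

/-- Achievability asks for a code at every block length; constant transmission always meets the
constraints. -/
theorem nonempty_code (N : Network X₁ Y₁ X₂ Y₂) {P₁ P₂ : ℝ} (h₁ : ∃ x₁, N.c₁ x₁ ≤ P₁)
    (h₂ : ∃ x₂, ∀ y₁, N.c₂ x₂ ≤ N.b y₁ + P₂) {M n : ℕ} (hM : 0 < M) (hn : 0 < n) :
    Nonempty (Code N P₁ P₂ M n) := by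
  obtain ⟨x₁, hx₁⟩ := h₁
  obtain ⟨x₂, hx₂⟩ := h₂
  have hn' : (0 : ℝ) < n := Nat.cast_pos.2 hn
  refine ⟨⟨fun _ _ => x₁, fun _ _ => x₂, fun _ => ⟨0, hM⟩, fun m => ?_, fun m y _ => ?_⟩⟩
  · simpa [hn'.ne'] using hx₁
  · have := Finset.sum_le_sum fun i (_ : i ∈ Finset.univ) => hx₂ (y i)
    rw [Finset.sum_add_distrib] at this
    simp only [Finset.sum_const, Finset.card_univ, Fintype.card_fin, nsmul_eq_mul] at this
    rw [one_div, inv_mul_le_iff₀ hn', mul_add, mul_inv_cancel_left₀ hn'.ne']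
    simpa [relayWord] using this

theorem achievable_zero (N : Network X₁ Y₁ X₂ Y₂) {P₁ P₂ : ℝ} (h₁ : ∃ x₁, N.c₁ x₁ ≤ P₁)
    (h₂ : ∃ x₂, ∀ y₁, N.c₂ x₂ ≤ N.b y₁ + P₂) : Achievable N P₁ P₂ 0 := by
  refine ⟨le_rfl, fun n => (nonempty_code N h₁ h₂ (by positivity) n.pos).some,
    tendsto_const_nhds.congr fun n => ?_⟩
  symm
  have : Subsingleton (Fin (2 ^ ⌈((n : ℕ) : ℝ) * 0⌉₊)) := by
    simp only [mul_zero, Nat.ceil_zero, pow_zero]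
    infer_instance
  refine mul_eq_zero_of_right _ (Finset.sum_eq_zero fun m _ => Finset.sum_eq_zero fun y₁ _ =>
    Finset.sum_eq_zero fun y₂ _ => if_neg (not_not.2 (Subsingleton.elim _ _)))

/-- It suffices to find good codes for each error bound separately. -/
theorem achievable_of_eventually (N : Network X₁ Y₁ X₂ Y₂) {P₁ P₂ R : ℝ}
    (h₁ : ∃ x₁, N.c₁ x₁ ≤ P₁) (h₂ : ∃ x₂, ∀ y₁, N.c₂ x₂ ≤ N.b y₁ + P₂) (hR : 0 ≤ R)
    (h : ∀ ε > 0, ∀ᶠ n : ℕ in atTop, ∃ C : Code N P₁ P₂ (2 ^ ⌈(n : ℝ) * R⌉₊) n,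
      C.errorProb ≤ ε) : Achievable N P₁ P₂ R := by
  -- One sequence must serve all error bounds: for each n, take a code whose error is within 1 / n
  -- of the infimum.
  have hex : ∀ n : ℕ+, ∃ C : Code N P₁ P₂ (2 ^ ⌈((n : ℕ) : ℝ) * R⌉₊) (n : ℕ),
      ∀ C' : Code N P₁ P₂ (2 ^ ⌈((n : ℕ) : ℝ) * R⌉₊) (n : ℕ),
        C.errorProb ≤ C'.errorProb + 1 / ((n : ℕ) : ℝ) := by
    intro n
    obtain ⟨C₀⟩ := nonempty_code N h₁ h₂ (M := 2 ^ ⌈((n : ℕ) : ℝ) * R⌉₊) (by positivity) n.pos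
    have hbdd : BddBelow (Set.range fun C : Code N P₁ P₂ (2 ^ ⌈((n : ℕ) : ℝ) * R⌉₊) (n : ℕ) =>
        C.errorProb) := ⟨0, by rintro _ ⟨C, rfl⟩; exact C.errorProb_nonneg⟩
    have hn : 0 < 1 / ((n : ℕ) : ℝ) := by
      have := n.pos
      positivity
    obtain ⟨_, ⟨C, rfl⟩, hC⟩ := exists_lt_of_csInf_lt
      (Set.range_nonempty_iff_nonempty.2 ⟨C₀⟩) (lt_add_of_pos_right _ hn)
    exact ⟨C, fun C' => hC.le.trans (by gcongr; exact csInf_le hbdd ⟨C', rfl⟩)⟩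
  choose C hC using hex
  refine ⟨hR, C, ?_⟩
  rw [Metric.tendsto_nhds]
  intro ε hε
  have hinv := tendsto_PNat_val_atTop_atTop.eventually
    (tendsto_one_div_atTop_nhds_zero_nat.eventually_lt_const (half_pos hε))
  filter_upwards [tendsto_PNat_val_atTop_atTop.eventually (h (ε / 2) (half_pos hε)), hinv] with n hn hn'
  obtain ⟨C', hC'⟩ := hn
  rw [Real.dist_eq, sub_zero, abs_of_nonneg (C n).errorProb_nonneg]
  have := hC n C'
  linarith

/-- Here β is the energy per letter that decoding a first-hop block guarantees, and with P₂ it is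
the budget of the second-hop codewords. -/
theorem achievable_of_eventuallyAbove [Fintype X₁] [Fintype X₂] (N : Network X₁ Y₁ X₂ Y₂)
    {P₁ P₂ R bm β : ℝ} (h₁ : ∃ x₁, N.c₁ x₁ ≤ P₁) {x₀ : X₂} {y₀ : Y₁}
    (hbm : ∀ y, bm ≤ N.b y) (hx₀ : N.c₂ x₀ ≤ bm + P₂) (hβ : bm ≤ β) (hR0 : 0 ≤ R)
    {p₁ : X₁ → ℝ} (hp₁ : p₁ ∈ stdSimplex ℝ X₁) {p₂ : X₂ → ℝ} (hp₂ : p₂ ∈ stdSimplex ℝ X₂)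
    (hR₁ : R < N.W₁.info p₁) (hR₂ : R < N.W₂.info p₂)
    (hc₁ : EventuallyAbove p₁ (fun x => -N.c₁ x) (-P₁))
    (hb : EventuallyAbove (N.W₁.out p₁) N.b β)
    (hc₂ : EventuallyAbove p₂ (fun x => -N.c₂ x) (-(β + P₂))) : Achievable N P₁ P₂ R := by
  refine achievable_of_eventually N h₁ ⟨x₀, fun y => hx₀.trans (by linarith [hbm y])⟩ hR0
    fun ε hε => ?_
  obtain ⟨x₁, hx₁⟩ := h₁
  obtain ⟨S, hRS, hS⟩ := exists_between (lt_min hR₁ hR₂)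
  have hS0 : 0 ≤ S := hR0.trans hRS.le
  -- Chosen so that K sub-messages of rate S spread over K + 1 blocks still exceed rate R.
  obtain ⟨K, hK⟩ := exists_nat_gt (R / (S - R))
  have hgap : 0 < K * S - (K + 1) * R := by
    rw [div_lt_iff₀ (sub_pos.2 hRS)] at hK
    linarith
  have hK0 : 0 < (K : ℝ) := lt_of_le_of_lt (div_nonneg hR0 (sub_pos.2 hRS).le) hK
  have hε' : 0 < ε / (2 * K) := by positivity
  have hdiv : Tendsto (fun n : ℕ => n / (K + 1)) atTop atTop :=
    Nat.tendsto_div_const_atTop (Nat.succ_ne_zero K)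
  have hzero : EventuallyAbove (N.W₂.out p₂) (fun _ => 0) 0 := Or.inr fun _ _ => le_rfl
  filter_upwards [
    hdiv.eventually (N.W₁.exists_block_code hp₁ hS0 (hS.trans_le (min_le_left _ _)) hc₁ hb hε'),
    hdiv.eventually (N.W₂.exists_block_code hp₂ hS0 (hS.trans_le (min_le_right _ _)) hc₂ hzero hε'),
    hdiv.eventually (eventually_gt_atTop 0),
    hdiv.eventually (tendsto_natCast_atTop_atTop.eventually_ge_atTop
      ((K + 1) * R / (K * S - (K + 1) * R)))] with n hcode₁ hcode₂ hl hlarge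
  obtain ⟨enc₁, D₁, hD₁, hcost₁, hharvest, herr₁⟩ := hcode₁
  obtain ⟨enc₂, D₂, hD₂, hcost₂, -, herr₂⟩ := hcode₂
  -- The block length is n / (K + 1) rounded down; by `hlarge` the gap `K * S - (K + 1) * R` absorbs
  -- the rounding.
  have hexp : ⌈(n : ℝ) * R⌉₊ ≤ ⌈((n / (K + 1) : ℕ) : ℝ) * S⌉₊ * K := by
    rw [Nat.ceil_le]
    push_cast
    have hlt : (n : ℝ) ≤ (K + 1) * (((n / (K + 1) : ℕ) : ℝ) + 1) := by
      exact_mod_cast (Nat.lt_mul_div_succ n (Nat.succ_pos K)).le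
    rw [div_le_iff₀ hgap] at hlarge
    calc (n : ℝ) * R ≤ (K + 1) * (((n / (K + 1) : ℕ) : ℝ) + 1) * R := by gcongr
      _ ≤ ((n / (K + 1) : ℕ) : ℝ) * S * K := by linarith
      _ ≤ _ := by gcongr; exact Nat.le_ceil _
  obtain ⟨C, hC⟩ := exists_code_of_block_codes N hε'.le hx₁ (y₀ := y₀) hbm hx₀ hβ hl
    (Nat.pow_pos two_pos) (Nat.pow_pos (n := ⌈(n : ℝ) * R⌉₊) two_pos) (Nat.mul_div_le n (K + 1))
    (by rw [← pow_mul]; exact Nat.pow_le_pow_right two_pos hexp)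
    hD₁ hcost₁ hharvest herr₁ hD₂ hcost₂ herr₂
  refine ⟨C, hC.trans (le_of_eq ?_)⟩
  field_simp

/-- Every rate below the mutual informations of a feasible pair of inputs is achievable. -/
theorem achievable_of_lt_info [Fintype X₁] [Fintype X₂] (N : Network X₁ Y₁ X₂ Y₂) {P₁ P₂ R : ℝ}
    (h₁ : ∃ x₁, N.c₁ x₁ ≤ P₁) (h₂ : ∃ x₂, ∀ y₁, N.c₂ x₂ ≤ N.b y₁ + P₂) (hR0 : 0 ≤ R)
    {p₁ : X₁ → ℝ} (hp₁ : p₁ ∈ inputs₁ N P₁) {p₂ : X₂ → ℝ}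
    (hp₂ : p₂ ∈ inputs₂ N (harvest N p₁ + P₂)) (hR₁ : R < N.W₁.info p₁)
    (hR₂ : R < N.W₂.info p₂) : Achievable N P₁ P₂ R := by
  have : Nonempty X₁ := ⟨h₁.choose⟩
  have : Nonempty X₂ := ⟨h₂.choose⟩
  have : Nonempty Y₁ := by
    by_contra hcon
    rw [not_nonempty_iff] at hcon
    simpa using N.W₁.sum_one h₁.choose
  obtain ⟨x₁, hx₁⟩ := Finite.exists_min N.c₁
  obtain ⟨x₀, hx₀⟩ := Finite.exists_min N.c₂
  obtain ⟨y₀, hy₀⟩ := Finite.exists_min N.b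
  have hx₁P : N.c₁ x₁ ≤ P₁ := (hx₁ _).trans h₁.choose_spec
  have hx₀P : N.c₂ x₀ ≤ N.b y₀ + P₂ := (hx₀ _).trans (h₂.choose_spec y₀)
  obtain ⟨q₁, hq₁, hlim₁, hcost₁⟩ := exists_tendsto_cheaper hp₁.1 hx₁ hp₁.2
  obtain ⟨q₂, hq₂, hlim₂, hcost₂⟩ := exists_tendsto_cheaper hp₂.1 hx₀ hp₂.2
  have hc₁ : ∀ j, EventuallyAbove (q₁ j) (fun x => -N.c₁ x) (-P₁) := fun j =>
    eventuallyAbove_neg (hcost₁.imp (fun h => h j) fun h x hx => (h j x hx).trans hx₁P)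
  have hI₁ := (N.W₁.tendsto_info hp₁.1 hq₁ hlim₁).eventually_const_lt hR₁
  obtain ⟨k, hk⟩ := ((N.W₂.tendsto_info hp₂.1 hq₂ hlim₂).eventually_const_lt hR₂).exists
  -- With slack in the relay's cost, the approximant of p₂ is fixed first, then one of p₁ whose
  -- harvest still pays for it. β is put strictly below that harvest, unless the harvest is only the
  -- least value of b, which is then received surely.
  rcases hcost₂ with hcost₂ | hcost₂
  · have hharvest := (((continuous_harvest N).tendsto p₁).comp hlim₁).eventually_const_lt
      (show ∑ x, q₂ k x * N.c₂ x - P₂ < harvest N p₁ by linarith [hcost₂ k])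
    obtain ⟨j, hj, hjh⟩ := (hI₁.and hharvest).exists
    simp only [Function.comp] at hjh
    by_cases hlt : N.b y₀ < harvest N (q₁ j)
    · obtain ⟨β, hβ, hβh⟩ := exists_between (max_lt hlt hjh)
      refine achievable_of_eventuallyAbove N h₁ (y₀ := y₀) hy₀ hx₀P
        ((le_max_left _ _).trans hβ.le) hR0 (hq₁ j) (hq₂ k) hj hk (hc₁ j) ?_ ?_
      · exact Or.inl (by rwa [sum_out_mul_eq_harvest])
      · exact eventuallyAbove_neg (Or.inl (by linarith [(le_max_right _ _).trans_lt hβ]))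
    · refine achievable_of_eventuallyAbove N h₁ (y₀ := y₀) hy₀ hx₀P le_rfl hR0 (hq₁ j) (hq₂ k)
        hj hk (hc₁ j) (Or.inr fun y _ => hy₀ y) ?_
      exact eventuallyAbove_neg (Or.inl (by linarith))
  -- The relay uses only its cheapest symbols, affordable even from the least harvest.
  · obtain ⟨j, hj⟩ := hI₁.exists
    exact achievable_of_eventuallyAbove N h₁ (y₀ := y₀) hy₀ hx₀P le_rfl hR0 (hq₁ j) (hq₂ k) hj hk
      (hc₁ j) (Or.inr fun y _ => hy₀ y)
      (eventuallyAbove_neg (Or.inr fun x hx => (hcost₂ k x hx).trans hx₀P))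

end Achievability

/-! ### The converse for the two-hop channel, and the supremum -/

section Network

variable {X₁ Y₁ X₂ Y₂ : Type*} [Fintype X₁] [Fintype Y₁] [Fintype X₂] [Fintype Y₂]

/-- The converse for a single code. -/
theorem Code.exists_inputs {N : Network X₁ Y₁ X₂ Y₂} {P₁ P₂ : ℝ} {M n : ℕ}
    (C : Code N P₁ P₂ M n) (hM : 0 < M) (hn : 0 < n) :
    ∃ p₁ ∈ inputs₁ N P₁, ∃ p₂ ∈ inputs₂ N (harvest N p₁ + P₂),
      (1 - C.errorProb) * Real.logb 2 M - 1 ≤ n * N.W₁.info p₁ ∧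
      (1 - C.errorProb) * Real.logb 2 M - 1 ≤ n * N.W₂.info p₂ := by
  classical
  have hM' : (0 : ℝ) < M := Nat.cast_pos.2 hM
  have hn' : (0 : ℝ) < n := Nat.cast_pos.2 hn
  set f := relayWord C.relay with hf
  let w₁ : Fin M → ℝ := fun _ => 1 / M
  have hw₁ : w₁ ∈ stdSimplex ℝ (Fin M) := ⟨fun _ => by positivity, by simp [w₁, hM'.ne']⟩
  let w₂ : Fin M × (Fin n → Y₁) → ℝ := fun a => 1 / M * N.W₁.wordProb (C.enc a.1) a.2
  have hw₂ : w₂ ∈ stdSimplex ℝ (Fin M × (Fin n → Y₁)) := by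
    refine ⟨fun a => mul_nonneg (by positivity) (N.W₁.wordProb_nonneg _ _), ?_⟩
    rw [Fintype.sum_prod_type]
    simp_rw [w₂, ← Finset.mul_sum, N.W₁.sum_wordProb]
    simp [hM'.ne']
  -- Seen from the first hop, the second channel and the decoder form a randomized test of the
  -- message. Seen from the second hop, the channel input is indexed by the message together with
  -- the relay's received word.
  let T₁ : Fin M → (Fin n → Y₁) → ℝ := fun m y₁ =>
    ∑ y₂, N.W₂.wordProb (f y₁) y₂ * if C.dec y₂ = m then 1 else 0
  let T₂ : Fin M × (Fin n → Y₁) → (Fin n → Y₂) → ℝ := fun a y₂ =>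
    if C.dec y₂ = a.1 then 1 else 0
  have hite : ∀ Q : Prop, [Decidable Q] → (0 : ℝ) ≤ (if Q then 1 else 0) ∧
      (if Q then 1 else 0) ≤ (1 : ℝ) := fun Q _ => by split_ifs <;> simp
  have hacc₁ : ∑ m, ∑ y₁, w₁ m * N.W₁.wordProb (C.enc m) y₁ * T₁ m y₁ = 1 - C.errorProb := by
    have htot : ∑ m, ∑ y₁, w₁ m * N.W₁.wordProb (C.enc m) y₁ *
        ∑ y₂, N.W₂.wordProb (f y₁) y₂ = 1 := by
      simp_rw [N.W₂.sum_wordProb, mul_one, ← Finset.mul_sum, N.W₁.sum_wordProb, mul_one]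
      exact hw₁.2
    have herr : C.errorProb = ∑ m, ∑ y₁, w₁ m * N.W₁.wordProb (C.enc m) y₁ *
        ∑ y₂, N.W₂.wordProb (f y₁) y₂ * (if C.dec y₂ ≠ m then 1 else 0) := by
      unfold Code.errorProb
      simp_rw [Finset.mul_sum, w₁]
      refine Finset.sum_congr rfl fun m _ => Finset.sum_congr rfl fun y₁ _ =>
        Finset.sum_congr rfl fun y₂ _ => ?_
      split_ifs <;> simp [hf, mul_assoc]
    rw [herr, eq_sub_iff_add_eq, ← Finset.sum_add_distrib]
    refine Eq.trans ?_ htot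
    refine Finset.sum_congr rfl fun m _ => ?_
    rw [← Finset.sum_add_distrib]
    refine Finset.sum_congr rfl fun y₁ _ => ?_
    rw [← mul_add, ← Finset.sum_add_distrib]
    congr 1
    refine Finset.sum_congr rfl fun y₂ _ => ?_
    by_cases h : C.dec y₂ = m <;> simp [h]
  have hacc₂ : ∑ a, ∑ y₂, w₂ a * N.W₂.wordProb (f a.2) y₂ * T₂ a y₂ = 1 - C.errorProb := by
    rw [← hacc₁, Fintype.sum_prod_type]
    simp_rw [w₁, w₂, T₁, T₂, Finset.mul_sum, mul_assoc]
  have hbayes : ∀ y₂, ∑ m, w₁ m * (if C.dec y₂ = m then 1 else 0) ≤ 1 / (M : ℝ) := fun y₂ => by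
    simp [w₁]
  have hconv₁ := N.W₁.accept_mul_logb_le hw₁ hn C.enc T₁
    (fun m y₁ => Finset.sum_nonneg fun y₂ _ => mul_nonneg (N.W₂.wordProb_nonneg _ _) (hite _).1)
    (fun m y₁ => by
      refine (Finset.sum_le_sum fun y₂ _ => mul_le_mul_of_nonneg_left (hite _).2
        (N.W₂.wordProb_nonneg (f y₁) y₂)).trans ?_
      simp [N.W₂.sum_wordProb]) hM' (fun y₁ => by
      simp_rw [T₁, Finset.mul_sum]
      rw [Finset.sum_comm]
      calc ∑ y₂, ∑ m, w₁ m * (N.W₂.wordProb (f y₁) y₂ * if C.dec y₂ = m then 1 else 0)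
          = ∑ y₂, N.W₂.wordProb (f y₁) y₂ * ∑ m, w₁ m * (if C.dec y₂ = m then 1 else 0) := by
            simp_rw [Finset.mul_sum]
            exact Finset.sum_congr rfl fun _ _ => Finset.sum_congr rfl fun _ _ => by ring
        _ ≤ ∑ y₂, N.W₂.wordProb (f y₁) y₂ * (1 / M) := by
            gcongr with y₂
            · exact N.W₂.wordProb_nonneg _ _
            · exact hbayes y₂
        _ = 1 / M := by rw [← Finset.sum_mul, N.W₂.sum_wordProb, one_mul])
  have hconv₂ := N.W₂.accept_mul_logb_le hw₂ hn (fun a => f a.2) T₂ (fun a y₂ => (hite _).1)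
    (fun a y₂ => (hite _).2) hM' (fun y₂ => by
      rw [Fintype.sum_prod_type]
      refine le_trans (le_of_eq ?_) (hbayes y₂)
      refine Finset.sum_congr rfl fun m _ => ?_
      simp only [w₁, w₂, T₂]
      by_cases h : C.dec y₂ = m <;> simp [h, ← Finset.mul_sum, N.W₁.sum_wordProb])
  rw [hacc₁] at hconv₁
  rw [hacc₂] at hconv₂
  refine ⟨_, ⟨avgInput_mem_stdSimplex hn hw₁ C.enc, ?_⟩, _,
    ⟨avgInput_mem_stdSimplex hn hw₂ fun a => f a.2, ?_⟩, hconv₁, hconv₂⟩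
  · rw [sum_avgInput_mul, Finset.mul_sum]
    calc ∑ m, 1 / (n : ℝ) * (w₁ m * ∑ i, N.c₁ (C.enc m i))
        = ∑ m, w₁ m * (1 / (n : ℝ) * ∑ i, N.c₁ (C.enc m i)) :=
          Finset.sum_congr rfl fun _ _ => by ring
      _ ≤ ∑ m, w₁ m * P₁ := Finset.sum_le_sum fun m _ =>
          mul_le_mul_of_nonneg_left (C.enc_cost m) (hw₁.1 m)
      _ = P₁ := by rw [← Finset.sum_mul, hw₁.2, one_mul]
  · have hharvest : harvest N (avgInput w₁ C.enc) =
        ∑ a, w₂ a * (1 / (n : ℝ) * ∑ i, N.b (a.2 i)) := by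
      unfold harvest
      simp_rw [mul_assoc, ← Finset.mul_sum]
      rw [sum_avgInput_mul, Finset.mul_sum, Fintype.sum_prod_type]
      refine Finset.sum_congr rfl fun m _ => ?_
      have : ∑ y : Fin n → Y₁, N.W₁.wordProb (C.enc m) y * ∑ i, N.b (y i) =
          ∑ i, ∑ y, N.W₁.prob (C.enc m i) y * N.b y := by
        simp_rw [Finset.mul_sum]
        rw [Finset.sum_comm]
        exact Finset.sum_congr rfl fun i _ => sum_prod_apply (fun i => N.W₁.prob (C.enc m i))
          (fun i => N.W₁.sum_one _) i N.b
      rw [← this, Finset.mul_sum, Finset.mul_sum]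
      exact Finset.sum_congr rfl fun y _ => by simp only [w₁, w₂]; ring
    rw [sum_avgInput_mul, Finset.mul_sum, hharvest]
    calc ∑ a, 1 / (n : ℝ) * (w₂ a * ∑ i, N.c₂ (f a.2 i))
        = ∑ a, w₂ a * (1 / (n : ℝ) * ∑ i, N.c₂ (f a.2 i)) :=
          Finset.sum_congr rfl fun _ _ => by ring
      _ ≤ ∑ a, w₂ a * (1 / (n : ℝ) * ∑ i, N.b (a.2 i) + P₂) := by
          refine Finset.sum_le_sum fun a _ => ?_
          -- The relay's constraint is given only for words of positive probability; the others
          -- carry weight zero.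
          rcases (N.W₁.wordProb_nonneg (C.enc a.1) a.2).eq_or_lt with h | h
          · simp [w₂, ← h]
          · exact mul_le_mul_of_nonneg_left (C.relay_cost a.1 a.2 h) (hw₂.1 a)
      _ = _ := by simp_rw [mul_add, Finset.sum_add_distrib, ← Finset.sum_mul, hw₂.2, one_mul]

theorem Achievable.le {N : Network X₁ Y₁ X₂ Y₂} {P₁ P₂ R V : ℝ}
    (h : Achievable N P₁ P₂ R) (hV : ∀ p₁ ∈ inputs₁ N P₁,
      min (N.W₁.info p₁) (secondHop N (harvest N p₁ + P₂)) ≤ V) : R ≤ V := by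
  obtain ⟨hR, C, hC⟩ := h
  have hbound : ∀ᶠ n : ℕ+ in atTop, (1 - (C n).errorProb) * R - 1 / ((n : ℕ) : ℝ) ≤ V := by
    -- An error probability of at most 1 keeps the factor in front of the logarithm nonnegative, so
    -- the logarithm may be replaced by its lower bound n R.
    filter_upwards [hC.eventually_le_const one_pos] with n hn
    obtain ⟨p₁, hp₁, p₂, hp₂, hI₁, hI₂⟩ := (C n).exists_inputs (by positivity) n.pos
    have hn0 : (0 : ℝ) < ((n : ℕ) : ℝ) := Nat.cast_pos.2 n.pos
    have hlog : ((n : ℕ) : ℝ) * R ≤ Real.logb 2 ((2 ^ ⌈((n : ℕ) : ℝ) * R⌉₊ : ℕ) : ℝ) := by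
      push_cast
      rw [Real.logb_pow, Real.logb_self_eq_one one_lt_two, mul_one]
      exact Nat.le_ceil _
    have hlog' := mul_le_mul_of_nonneg_left hlog (sub_nonneg.2 hn)
    have hmin : (1 - (C n).errorProb) * R - 1 / ((n : ℕ) : ℝ) ≤
        min (N.W₁.info p₁) (N.W₂.info p₂) := by
      have hcancel : ((n : ℕ) : ℝ) * ((1 - (C n).errorProb) * R - 1 / ((n : ℕ) : ℝ)) =
          (1 - (C n).errorProb) * (((n : ℕ) : ℝ) * R) - 1 := by
        field_simp
      exact le_min (le_of_mul_le_mul_left (by linarith) hn0)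
        (le_of_mul_le_mul_left (by linarith) hn0)
    refine hmin.trans ((min_le_min_left _ ?_).trans (hV p₁ hp₁))
    exact (isGreatest_secondHop N ⟨p₂, hp₂⟩).2 ⟨p₂, hp₂, rfl⟩
  have hlim : Tendsto (fun n : ℕ+ => (1 - (C n).errorProb) * R - 1 / ((n : ℕ) : ℝ)) atTop
      (𝓝 ((1 - 0) * R - 0)) :=
    ((tendsto_const_nhds.sub hC).mul_const R).sub
      ((tendsto_one_div_atTop_nhds_zero_nat (𝕜 := ℝ)).comp tendsto_PNat_val_atTop_atTop)
  rw [sub_zero, sub_zero, one_mul] at hlim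
  exact le_of_tendsto hlim hbound

theorem isLUB_achievable (N : Network X₁ Y₁ X₂ Y₂) {P₁ P₂ V : ℝ} (h₁ : ∃ x₁, N.c₁ x₁ ≤ P₁)
    (h₂ : ∃ x₂, ∀ y₁, N.c₂ x₂ ≤ N.b y₁ + P₂)
    (hV : IsGreatest ((fun p₁ => min (N.W₁.info p₁) (secondHop N (harvest N p₁ + P₂))) ''
      inputs₁ N P₁) V) : IsLUB {R | Achievable N P₁ P₂ R} V := by
  refine ⟨fun R hR => Achievable.le hR fun p₁ hp₁ => hV.2 ⟨p₁, hp₁, rfl⟩, fun U hU => ?_⟩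
  by_contra! hlt
  have hU0 : 0 ≤ U := hU (achievable_zero N h₁ h₂)
  obtain ⟨R, hUR, hRV⟩ := exists_between hlt
  obtain ⟨p₁, hp₁, hp₁V⟩ := hV.1
  obtain ⟨p₂, hp₂, hp₂V⟩ :=
    (isGreatest_secondHop N (inputs₂_harvest_nonempty N h₂ hp₁.1)).1
  dsimp only at hp₁V
  rw [← hp₁V, ← hp₂V] at hRV
  exact hUR.not_ge (hU (achievable_of_lt_info N h₁ h₂ (hU0.trans hUR.le) hp₁ hp₂
    (hRV.trans_le (min_le_left _ _)) (hRV.trans_le (min_le_right _ _))))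

end Network

end MultiHop

theorem theorem2 {X₁ Y₁ X₂ Y₂ : Type*} [Fintype X₁] [Fintype Y₁] [Fintype X₂] [Fintype Y₂]
    (N : MultiHop.Network X₁ Y₁ X₂ Y₂) (P₁ P₂ : ℝ)
    (h₁ : ∃ x₁, N.c₁ x₁ ≤ P₁) (h₂ : ∃ x₂, ∀ y₁, N.c₂ x₂ ≤ N.b y₁ + P₂) :
    -- the capacity is the supremum of a nonempty set of reals that is bounded above
    IsLUB {R | MultiHop.Achievable N P₁ P₂ R} (MultiHop.capacityEnergy N P₁ P₂) ∧
    -- the inner maximum is attained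
    (∀ p₁ ∈ MultiHop.inputs₁ N P₁,
      IsGreatest (N.W₂.info '' MultiHop.inputs₂ N (MultiHop.harvest N p₁ + P₂))
        (MultiHop.secondHop N (MultiHop.harvest N p₁ + P₂))) ∧
    -- the outer maximum is attained and equals the capacity
    IsGreatest
      ((fun p₁ => min (N.W₁.info p₁) (MultiHop.secondHop N (MultiHop.harvest N p₁ + P₂))) ''
        MultiHop.inputs₁ N P₁)
      (MultiHop.capacityEnergy N P₁ P₂) := by
  obtain ⟨V, hV⟩ := MultiHop.exists_isGreatest_min N h₁ h₂
  have hlub := MultiHop.isLUB_achievable N h₁ h₂ hV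
  have hcap : MultiHop.capacityEnergy N P₁ P₂ = V := hlub.csSup_eq hlub.nonempty
  rw [hcap]
  exact ⟨hlub, fun p₁ hp₁ => MultiHop.isGreatest_secondHop N
    (MultiHop.inputs₂_harvest_nonempty N h₂ hp₁.1), hV⟩
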